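/- Graphs are finite, undirected and weighted with positive real edge weights; loops are allowed, multiple edges are not. $A(X)$ is the weighted adjacency matrix of $X$, $\phi(A(X),t)$ its characteristic polynomial, and $X$ is *weighted $k$-regular* if every row sum of $A(X)$ equals $k$. The join $X\vee Y$ is obtained from the disjoint union of $X$ and $Y$ by joining every vertex of $X$ to every vertex of $Y$ by an edge of weight one. *Adjacency perfect state transfer* (PST) occurs between $u$ and $v$ in $X$ if $|(e^{i\tau A(X)})_{u,v}|=1$ for some time $\tau$; the least such $\tau>0$ is the *minimum PST time*. Let $E_\lambda$ be the orthogonal projection onto the $\lambda$-eigenspace of a real symmetric matrix $M$ indexed by vertices, and let $\mathbf e_u$ be the characteristic vector of $u$. Put $\sigma_u(M)=\{\lambda: E_\lambda\mathbf e_u\ne 0\}$, $\sigma_{uv}^{\pm}(M)=\{\lambda: E_\lambda\mathbf e_u=\pm E_\lambda\mathbf e_v\neq 0\}$; $u,v$ are *(adjacency) strongly cospectral* in $X$ if $E_\lambda\mathbf e_u=\pm E_\lambda\mathbf e_v$ for every $\lambda$, where $M=A(X)$. Let $O_2(k)$ be the graph with two vertices, no edge between them, and a loop of weight $k$ at each vertex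 (no loop if $k=0$). Let $\nu_2(a)$ be the exponent of the largest power of $2$ dividing the integer $a$, with $\nu_2(0)=\infty$. **Theorem.** Let $X$ be a weighted $k$-regular graph on $m\ge 2$ vertices and $Y$ a weighted $\ell$-regular graph on $n\ge 1$ vertices, where $k,\ell\in\mathbb Z$ and $\phi(A(X),t)\in\mathbb Z[t]$. Put $D=(k-\ell)^2+4mn$ and $\lambda^{\pm}=\frac12(k+\ell\pm\sqrt D)$. Let $\mathcal R=\{\lambda^+,\lambda^-\}$ if $X$ is connected and $\mathcal R=\{\lambda^+,\lambda^-,k\}$ otherwise. Let $u\ne v$ be vertices of $X$. If $X=O_2(k)$, put $S^+=\{\lambda^+,\lambda^-\}$ and $S^-=\{k\}$; otherwise put $S^+=(\sigma_{uv}^+(A(X))\setminus\{k\})\cup\mathcal R$ and $S^-=\sigma_{uv}^-(A(X))$. Then adjacency PST occurs between $u$ and $v$ in $X\vee Y$ if and only if all of the following hold. 1. Either (i) $u$ and $v$ are adjacency strongly cospectral in $X$ and $\lambda^-\notin\sigma_{uv}^-(A(X))$, or (ii) $X=O_2(k)$. 2. One of the following holds. (a) All elements of $\sigma_u(A(X))$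 are integers and $D$ is a perfect square. In this case put $\Delta=1$. (b) $X$ is connected, or $X=O_2(k)$ and $k=\ell$; and there are integers $b$ and $\Delta>1$ with $\Delta$ square-free such that $\lambda^{\pm}=\frac12(k+\ell\pm b\sqrt\Delta)$ and each $\lambda_j\in\sigma_u(A(X))\setminus\{k\}$ is of the form $\frac12(k+\ell+b_j\sqrt\Delta)$ with $b_j$ an integer and $b_j<b$. 3. With this $\Delta$, for all $\lambda,\eta\in S^+$ and $\mu,\theta\in S^-$ the numbers $\frac{\lambda-\eta}{\sqrt\Delta},\frac{\lambda-\mu}{\sqrt\Delta},\frac{\lambda-\theta}{\sqrt\Delta}$ are integers and $$\nu_2\!\left(\tfrac{\lambda-\eta}{\sqrt\Delta}\right)>\nu_2\!\left(\tfrac{\lambda-\mu}{\sqrt\Delta}\right)=\nu_2\!\left(\tfrac{\lambda-\theta}{\sqrt\Delta}\right).$$ Further, if adjacency PST occurs between $u$ and $v$ in $X\vee Y$, then for $\Delta$ as in 2 and any fixed $\lambda_0\in(\sigma_{uv}^+(A(X\vee Y))\setminus\{k\})\cup\mathcal R$, the set $$\mathcal T=\left\{\tfrac{\lambda_0-\lambda}{\sqrt\Delta}:\lambda\in(\sigma_u(A(X\vee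 Y))\setminus\{k\})\cup\mathcal R\right\}$$ consists of integers, and the minimum PST time between $u$ and $v$ in $X\vee Y$ is $\frac{\pi}{g\sqrt\Delta}$, where $g=\gcd(\mathcal T)$. -/

import Mathlib

/-- A weighted undirected graph on the vertex set `V`, with possible loops and no multiple edges.
The edges have positive weights; weight `0` means that there is no edge. -/
structure WGraph (V : Type*) where
  weight : V → V → ℝ
  weight_symm : ∀ u v, weight u v = weight v u
  weight_nonneg : ∀ u v, 0 ≤ weight u v

namespace WGraph

variable {V W : Type*}

/-- The adjacency matrix `A(X)`. -/
def adjMatrix (X : WGraph V) : Matrix V V ℝ := Matrix.of X.weight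

/-- Weighted `k`-regular: all row sums of the adjacency matrix are equal to `k`
(so a loop contributes its weight once). -/
def IsWeightedRegular [Fintype V] (X : WGraph V) (k : ℝ) : Prop :=
  ∀ u, ∑ v, X.weight u v = k

/-- The underlying simple graph (loops and weights forgotten). -/
def toSimple (X : WGraph V) : SimpleGraph V where
  Adj u v := u ≠ v ∧ 0 < X.weight u v
  symm := ⟨fun u v h => ⟨h.1.symm, by rw [X.weight_symm]; exact h.2⟩⟩
  loopless := ⟨fun _ h => h.1 rfl⟩

/-- Connectedness of a weighted graph. -/
def IsConnected (X : WGraph V) : Prop := X.toSimple.Connected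

/-- The join `X ∨ Y`: each vertex of `X` is joined to each vertex of `Y` by an edge of weight
one. -/
def join (X : WGraph V) (Y : WGraph W) : WGraph (V ⊕ W) where
  weight
    | .inl u, .inl v => X.weight u v
    | .inr u, .inr v => Y.weight u v
    | .inl _, .inr _ => 1
    | .inr _, .inl _ => 1
  weight_symm := by
    rintro (u | u) (v | v)
    · exact X.weight_symm u v
    · rfl
    · rfl
    · exact Y.weight_symm u v
  weight_nonneg := by
    rintro (u | u) (v | v)
    · exact X.weight_nonneg u v
    · exact zero_le_one
    · exact zero_le_one
    · exact Y.weight_nonneg u v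

/-- `X = O₂(k)`: two vertices, no edge between them, and a loop of weight `k` on each vertex
(no loop if `k = 0`). -/
def IsO2 [Fintype V] (X : WGraph V) (k : ℝ) : Prop :=
  Fintype.card V = 2 ∧ (∀ u, X.weight u u = k) ∧ ∀ u v, u ≠ v → X.weight u v = 0

variable [Fintype V] [DecidableEq V] [Fintype W]

/-- The transition matrix `U_A(X,t) = exp(i t A(X))` of the quantum walk with Hamiltonian
`A(X)`. -/
noncomputable def transition (X : WGraph V) (t : ℝ) : Matrix V V ℂ :=
  NormedSpace.exp ((Complex.I * (t : ℂ)) • X.adjMatrix.map (fun x : ℝ => (x : ℂ)))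

/-- Adjacency perfect state transfer between `u` and `v`. -/
def HasPST (X : WGraph V) (u v : V) : Prop :=
  ∃ τ : ℝ, ‖X.transition τ u v‖ = 1

/-- `τ` is the minimum (adjacency) PST time between `u` and `v`. -/
def IsMinPSTTime (X : WGraph V) (u v : V) (τ : ℝ) : Prop :=
  IsLeast {t : ℝ | 0 < t ∧ ‖X.transition t u v‖ = 1} τ

/-- `E_x e_u`, where `E_x` is the orthogonal projection onto the eigenspace of `A(X)` for `x`
(it is zero when `x` is not an eigenvalue) and `e_u` is the characteristic vector of `u`. -/
noncomputable def eigProj (X : WGraph V) (x : ℝ) (u : V) : EuclideanSpace ℝ V :=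
  (Module.End.eigenspace (Matrix.toEuclideanLin X.adjMatrix) x).starProjection
    (EuclideanSpace.single u (1 : ℝ))

/-- The eigenvalue support `σ_u(A(X))`. -/
def supp (X : WGraph V) (u : V) : Set ℝ := {x | X.eigProj x u ≠ 0}

/-- Adjacency strong cospectrality of `u` and `v`. -/
def StronglyCospectral (X : WGraph V) (u v : V) : Prop :=
  ∀ x : ℝ, X.eigProj x u = X.eigProj x v ∨ X.eigProj x u = -X.eigProj x v

/-- `σ⁺_{uv}(A(X))`. -/
def suppPlus (X : WGraph V) (u v : V) : Set ℝ :=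
  {x | X.eigProj x u = X.eigProj x v ∧ X.eigProj x u ≠ 0}

/-- `σ⁻_{uv}(A(X))`. -/
def suppMinus (X : WGraph V) (u v : V) : Set ℝ :=
  {x | X.eigProj x u = -X.eigProj x v ∧ X.eigProj x u ≠ 0}

/-- The characteristic polynomial `φ(A(X),t)` has integer coefficients. -/
def HasIntegralCharpoly (X : WGraph V) : Prop :=
  ∃ p : Polynomial ℤ, X.adjMatrix.charpoly = p.map (Int.castRingHom ℝ)

end WGraph

namespace JoinPST

open WGraph

/-- `D = (k - ℓ)² + 4mn`. -/
def disc (m n : ℕ) (k l : ℤ) : ℤ := (k - l) ^ 2 + 4 * (m : ℤ) * (n : ℤ)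

/-- `λ⁺ = (k + ℓ + √D) / 2`. -/
noncomputable def lamPlus (m n : ℕ) (k l : ℤ) : ℝ :=
  ((k : ℝ) + (l : ℝ) + Real.sqrt ((disc m n k l : ℤ) : ℝ)) / 2

/-- `λ⁻ = (k + ℓ - √D) / 2`. -/
noncomputable def lamMinus (m n : ℕ) (k l : ℤ) : ℝ :=
  ((k : ℝ) + (l : ℝ) - Real.sqrt ((disc m n k l : ℤ) : ℝ)) / 2

variable {V : Type*} [Fintype V] [DecidableEq V]

/-- `R = {λ⁺, λ⁻}` if `X` is connected and `R = {λ⁺, λ⁻, k}` otherwise, where `Y` has `n`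
vertices. -/
def extra (X : WGraph V) (n : ℕ) (k l : ℤ) : Set ℝ :=
  {x | x = lamPlus (Fintype.card V) n k l ∨ x = lamMinus (Fintype.card V) n k l ∨
    (¬ X.IsConnected ∧ x = (k : ℝ))}

open Classical in
/-- The augmented set `S⁺`: it is `{λ⁺, λ⁻}` if `X = O₂(k)`, and
`(σ⁺_{uv}(A(X)) \ {k}) ∪ R` otherwise. -/
noncomputable def augPlus (X : WGraph V) (n : ℕ) (k l : ℤ) (u v : V) : Set ℝ :=
  if X.IsO2 (k : ℝ) then {lamPlus (Fintype.card V) n k l, lamMinus (Fintype.card V) n k l}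
  else (X.suppPlus u v \ {(k : ℝ)}) ∪ extra X n k l

open Classical in
/-- The set `S⁻`: it is `{k}` if `X = O₂(k)`, and `σ⁻_{uv}(A(X))` otherwise. -/
noncomputable def augMinus (X : WGraph V) (k : ℤ) (u v : V) : Set ℝ :=
  if X.IsO2 (k : ℝ) then {(k : ℝ)} else X.suppMinus u v

/-- The integral alternative: all elements of `σ_u(A(X))` are integers and `D` is a perfect
square. -/
def IntegralCase (X : WGraph V) (n : ℕ) (k l : ℤ) (u : V) : Prop :=
  (∀ x ∈ X.supp u, ∃ z : ℤ, x = (z : ℝ)) ∧ IsSquare (disc (Fintype.card V) n k l)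

/-- The quadratic alternative: `X` is connected (or `X = O₂(k)` with `k = ℓ`), each
`x ∈ σ_u(A(X)) \ {k}` is of the form `(k + ℓ + c √Δ) / 2`, and `λ^± = (k + ℓ ± b √Δ) / 2`, where
`c`, `b` are integers with `c < b` and `Δ > 1` is square-free. -/
def QuadraticCase (X : WGraph V) (n : ℕ) (k l : ℤ) (u : V) (Δ : ℕ) : Prop :=
  (X.IsConnected ∨ (X.IsO2 (k : ℝ) ∧ k = l)) ∧ 1 < Δ ∧ Squarefree Δ ∧
  ∃ b : ℤ,
    lamPlus (Fintype.card V) n k l = ((k : ℝ) + (l : ℝ) + (b : ℝ) * Real.sqrt (Δ : ℝ)) / 2 ∧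
    lamMinus (Fintype.card V) n k l = ((k : ℝ) + (l : ℝ) - (b : ℝ) * Real.sqrt (Δ : ℝ)) / 2 ∧
    ∀ x ∈ X.supp u \ {(k : ℝ)}, ∃ c : ℤ,
      x = ((k : ℝ) + (l : ℝ) + (c : ℝ) * Real.sqrt (Δ : ℝ)) / 2 ∧ c < b

/-- The eigenvalue condition with its parameter `Δ`, where `Δ = 1` in the integral case. -/
def EigenvalueCondition (X : WGraph V) (n : ℕ) (k l : ℤ) (u : V) (Δ : ℕ) : Prop :=
  (IntegralCase X n k l u ∧ Δ = 1) ∨ QuadraticCase X n k l u Δ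

/-- For all `x, y ∈ P` and `z, w ∈ N`, the numbers `(x - y)/√Δ`, `(x - z)/√Δ`, `(x - w)/√Δ` are
integers with `ν₂((x - y)/√Δ) > ν₂((x - z)/√Δ) = ν₂((x - w)/√Δ)`, where `ν₂(0) = ∞`. -/
def ValuationCondition (P N : Set ℝ) (Δ : ℕ) : Prop :=
  ∀ x ∈ P, ∀ y ∈ P, ∀ z ∈ N, ∀ w ∈ N, ∃ a b c : ℤ,
    (x - y) / Real.sqrt (Δ : ℝ) = (a : ℝ) ∧ (x - z) / Real.sqrt (Δ : ℝ) = (b : ℝ) ∧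
    (x - w) / Real.sqrt (Δ : ℝ) = (c : ℝ) ∧
    emultiplicity (2 : ℤ) a > emultiplicity (2 : ℤ) b ∧
    emultiplicity (2 : ℤ) b = emultiplicity (2 : ℤ) c

/-- `T` is a set of integers (viewed in `ℝ`) and `g` is its (nonnegative) greatest common
divisor. -/
def IsGCDOf (g : ℕ) (T : Set ℝ) : Prop :=
  ∃ T' : Set ℤ, T = (fun z : ℤ => (z : ℝ)) '' T' ∧
    (∀ z ∈ T', (g : ℤ) ∣ z) ∧ ∀ d : ℤ, (∀ z ∈ T', d ∣ z) → d ∣ (g : ℤ)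

end JoinPST

/-!
Everything is expressed through real eigenfunctions `f` of the adjacency matrix instead of spectral
projections: `E_x e_u = ± E_x e_v` means `f u = ± f v` for all eigenfunctions `f` for `x`, and
`E_x e_u ≠ 0` means that `f u ≠ 0` for some of them.

Since `exp(itA)` is unitary, state transfer at time `t` means that it maps `e_u` to `γ e_v` with
`|γ| = 1`. Tested against the eigenfunctions, this says that `u` and `v` are strongly cospectral and
that the phases `exp(itx)` have one common value on `σ⁺` and the opposite one on `σ⁻`
(`norm_transition_eq_one_iff_stronglyCospectral`).

In the join, constants on the two sides span an invariant plane on which `A(X ∨ Y)` has the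
eigenvalues `λ⁺` and `λ⁻`, the roots of `(x - k)(x - l) = mn`; all other eigenfunctions that matter
are eigenfunctions of `X` of mean zero, extended by zero. This gives the supports in the join and
shows that strong cospectrality in the join is strong cospectrality in `X` together with
`λ⁻ ∉ σ⁻`. The one exception arises from the eigenvalue `k`: if its mean-zero eigenfunctions take
opposite values at `u` and `v`, these lie in different components of `X`, all eigenfunctions for
other eigenvalues vanish at both, and `X = O₂(k)` (`isO2_of_stronglyCospectral_join`).

The phase condition forces the differences of eigenvalues in the support to be rational multiples
of `λ⁺ - λ⁻ = √D`. As the eigenvalues are algebraic integers, and a rational `q` with `q √Δ`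
integral and `Δ` square-free is an integer, they are integers or of the form `(k + l + c √Δ) / 2`.
If `X` is disconnected, then `k` is in the support; for nonsquare `D` this leaves only `k = l`, and
then an eigenvalue `k + e √Δ` of `X` with `e ≠ 0` would come with its conjugate `k - e √Δ`, although
no eigenvalue exceeds the degree (`exists_quadraticCase_of_rational`); there is such an eigenvalue
unless `X = O₂(k)`. Hence differences divided by `√Δ` are integers, and the phase condition becomes
a parity condition on `t √Δ / π` times these integers. It is solvable iff
the 2-adic valuations behave as stated, and its least positive solution is `π / (g √Δ)` for the
greatest common divisor `g` of the integers
(`IsPhaseTime.exists_isGCDOf_isLeast`).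
-/

/-! ### Eigenfunctions and eigenvalue supports -/

namespace WGraph

open Matrix

variable {V W : Type*}

theorem isHermitian_adjMatrix (X : WGraph V) : X.adjMatrix.IsHermitian := by
  ext i j
  simp [adjMatrix, X.weight_symm j i]

/-- `f` is an eigenfunction of `A(X)` for `x`, or zero: `A(X) f = x f`, written entrywise. -/
def IsEigenfunction [Fintype V] (X : WGraph V) (x : ℝ) (f : V → ℝ) : Prop :=
  ∀ a, ∑ b, X.weight a b * f b = x * f a

theorem isEigenfunction_iff_mulVec [Fintype V] (X : WGraph V) (x : ℝ) (f : V → ℝ) :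
    X.IsEigenfunction x f ↔ X.adjMatrix *ᵥ f = x • f := by
  simp [IsEigenfunction, funext_iff, Matrix.mulVec, dotProduct, adjMatrix]

theorem IsEigenfunction.add [Fintype V] {X : WGraph V} {x : ℝ} {f g : V → ℝ}
    (hf : X.IsEigenfunction x f) (hg : X.IsEigenfunction x g) :
    X.IsEigenfunction x (fun a => f a + g a) := by
  intro a
  simp only [mul_add, Finset.sum_add_distrib, hf a, hg a]

variable [Fintype V] [DecidableEq V]

theorem mem_eigenspace_iff (X : WGraph V) (x : ℝ) (f : EuclideanSpace ℝ V) :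
    f ∈ Module.End.eigenspace (Matrix.toEuclideanLin X.adjMatrix) x ↔
      X.IsEigenfunction x f := by
  rw [Module.End.mem_eigenspace_iff, isEigenfunction_iff_mulVec, Matrix.toLpLin_apply]
  constructor
  · intro h
    simpa using congrArg WithLp.ofLp h
  · intro h
    rw [h]
    rfl

theorem starProjection_eq_zero_iff_isEigenfunction (X : WGraph V) (x : ℝ)
    (y : EuclideanSpace ℝ V) :
    (Module.End.eigenspace (Matrix.toEuclideanLin X.adjMatrix) x).starProjection y = 0 ↔
      ∀ f : V → ℝ, X.IsEigenfunction x f → ∑ a, f a * y a = 0 := by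
  rw [Submodule.starProjection_apply_eq_zero_iff, Submodule.mem_orthogonal]
  constructor
  · intro h f hf
    have := h (WithLp.toLp 2 f) ((X.mem_eigenspace_iff x _).2 hf)
    rw [PiLp.inner_apply] at this
    simpa [mul_comm] using this
  · intro h f hf
    have := h f ((X.mem_eigenspace_iff x _).1 hf)
    rw [PiLp.inner_apply]
    simpa [mul_comm] using this

theorem eigProj_eq_iff (X : WGraph V) (x : ℝ) (u v : V) :
    X.eigProj x u = X.eigProj x v ↔ ∀ f, X.IsEigenfunction x f → f u = f v := by
  rw [← sub_eq_zero, eigProj, eigProj, ← map_sub, starProjection_eq_zero_iff_isEigenfunction]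
  simp [mul_sub, Finset.sum_sub_distrib, sub_eq_zero]

theorem eigProj_eq_neg_iff (X : WGraph V) (x : ℝ) (u v : V) :
    X.eigProj x u = -X.eigProj x v ↔ ∀ f, X.IsEigenfunction x f → f u = -f v := by
  rw [eq_neg_iff_add_eq_zero, eigProj, eigProj, ← map_add,
    starProjection_eq_zero_iff_isEigenfunction]
  simp [mul_add, Finset.sum_add_distrib, eq_neg_iff_add_eq_zero]

theorem mem_supp_iff (X : WGraph V) (x : ℝ) (u : V) :
    x ∈ X.supp u ↔ ∃ f, X.IsEigenfunction x f ∧ f u ≠ 0 := by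
  rw [supp, Set.mem_ofPred_eq, eigProj, Ne, starProjection_eq_zero_iff_isEigenfunction]
  push Not
  simp

theorem mem_suppPlus_iff (X : WGraph V) (x : ℝ) (u v : V) :
    x ∈ X.suppPlus u v ↔ (∀ f, X.IsEigenfunction x f → f u = f v) ∧ x ∈ X.supp u := by
  rw [suppPlus, Set.mem_ofPred_eq, eigProj_eq_iff]; rfl

theorem mem_suppMinus_iff (X : WGraph V) (x : ℝ) (u v : V) :
    x ∈ X.suppMinus u v ↔ (∀ f, X.IsEigenfunction x f → f u = -f v) ∧ x ∈ X.supp u := by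
  rw [suppMinus, Set.mem_ofPred_eq, eigProj_eq_neg_iff]; rfl

theorem stronglyCospectral_iff (X : WGraph V) (u v : V) :
    X.StronglyCospectral u v ↔ ∀ x : ℝ, (∀ f, X.IsEigenfunction x f → f u = f v) ∨
      ∀ f, X.IsEigenfunction x f → f u = -f v := by
  simp only [StronglyCospectral, eigProj_eq_iff, eigProj_eq_neg_iff]

theorem StronglyCospectral.supp_eq {X : WGraph V} {u v : V} (h : X.StronglyCospectral u v) :
    X.supp u = X.suppPlus u v ∪ X.suppMinus u v := by
  ext x
  rw [Set.mem_union, mem_suppPlus_iff, mem_suppMinus_iff]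
  have := (X.stronglyCospectral_iff u v).1 h x
  tauto

theorem not_mem_suppPlus_of_mem_suppMinus {X : WGraph V} {u v : V} {x : ℝ}
    (h : x ∈ X.suppMinus u v) : x ∉ X.suppPlus u v := by
  rw [mem_suppPlus_iff, mem_suppMinus_iff] at *
  rintro ⟨hp, hs⟩
  obtain ⟨f, hf, hfu⟩ := (X.mem_supp_iff x u).1 hs
  have h1 := hp f hf
  have h2 := h.1 f hf
  exact hfu (by linarith)

/-- Eigenfunctions span: only the zero vector is orthogonal to all of them. -/
theorem eq_zero_of_forall_isEigenfunction (X : WGraph V) (y : V → ℝ)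
    (h : ∀ x f, X.IsEigenfunction x f → ∑ a, f a * y a = 0) : y = 0 := by
  have hA := X.isHermitian_adjMatrix
  have h0 : (WithLp.toLp 2 y : EuclideanSpace ℝ V) = 0 := by
    refine InnerProductSpace.ext_inner_left_basis hA.eigenvectorBasis.toBasis fun i => ?_
    rw [inner_zero_right, OrthonormalBasis.coe_toBasis]
    have := h (hA.eigenvalues i) (hA.eigenvectorBasis i)
      ((X.isEigenfunction_iff_mulVec _ _).2 (hA.mulVec_eigenvectorBasis i))
    rw [PiLp.inner_apply]
    simpa [mul_comm] using this
  simpa using congrArg WithLp.ofLp h0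

/-! ### Perfect state transfer in terms of eigenvalues -/

theorem exp_mulVec_of_mulVec_eq_smul (M : Matrix V V ℂ) (z : ℂ) (f : V → ℂ)
    (h : M *ᵥ f = z • f) : NormedSpace.exp M *ᵥ f = Complex.exp z • f := by
  let _ : NormedRing (Matrix V V ℂ) := Matrix.linftyOpNormedRing
  let _ : NormedAlgebra ℂ (Matrix V V ℂ) := Matrix.linftyOpNormedAlgebra
  have hpow : ∀ n : ℕ, (M ^ n) *ᵥ f = z ^ n • f := by
    intro n
    induction n with
    | zero => simp
    | succ n ih =>
      rw [pow_succ, ← Matrix.mulVec_mulVec, h, Matrix.mulVec_smul, ih, smul_smul, pow_succ,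
        mul_comm]
  have h1 := (NormedSpace.exp_series_hasSum_exp' (𝕂 := ℂ) M).map
    (Matrix.mulVecBilin ℂ ℂ |>.flip f : Matrix V V ℂ →ₗ[ℂ] V → ℂ)
    (LinearMap.continuous_of_finiteDimensional _)
  have h2 := (NormedSpace.exp_series_hasSum_exp' (𝕂 := ℂ) z).smul_const f
  rw [← Complex.exp_eq_exp_ℂ] at h2
  refine h1.unique ?_
  convert h2 using 1
  funext n
  simp [hpow, smul_smul]

theorem sum_transition_mul (X : WGraph V) (t x : ℝ) (f : V → ℝ) (hf : X.IsEigenfunction x f)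
    (a : V) :
    ∑ b, X.transition t a b * (f b : ℂ) = Complex.exp (Complex.I * t * x) * f a := by
  have h := exp_mulVec_of_mulVec_eq_smul
    ((Complex.I * (t : ℂ)) • X.adjMatrix.map (fun x : ℝ => (x : ℂ)))
    (Complex.I * t * x) (fun b => (f b : ℂ)) (by
      funext a
      have := congrArg (fun r : ℝ => (r : ℂ)) (hf a)
      push_cast at this
      rw [Matrix.smul_mulVec, Pi.smul_apply, Pi.smul_apply, smul_eq_mul, smul_eq_mul,
        mul_assoc _ (x : ℂ), ← this]
      rfl)
  exact congrFun h a

theorem sum_norm_sq_transition (X : WGraph V) (t : ℝ) (a : V) :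
    ∑ b, ‖X.transition t a b‖ ^ 2 = 1 := by
  set M : Matrix V V ℂ := (Complex.I * (t : ℂ)) • X.adjMatrix.map (fun x : ℝ => (x : ℂ)) with hM
  have hadj : Mᴴ = -M := by
    ext i j
    simp [hM, adjMatrix, X.weight_symm j i]
  have h : NormedSpace.exp M * (NormedSpace.exp M)ᴴ = 1 := by
    rw [← Matrix.exp_conjTranspose, hadj, Matrix.exp_neg]
    exact Matrix.mul_nonsing_inv _ ((Matrix.isUnit_iff_isUnit_det _).1 (Matrix.isUnit_exp M))
  have h1 := congrFun (congrFun h a) a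
  rw [Matrix.mul_apply, Matrix.one_apply_eq] at h1
  have h2 : ∀ b, NormedSpace.exp M a b * (NormedSpace.exp M)ᴴ b a
      = ((‖X.transition t a b‖ ^ 2 : ℝ) : ℂ) := by
    intro b
    rw [Matrix.conjTranspose_apply, Complex.star_def, Complex.mul_conj, Complex.normSq_eq_norm_sq]
    rfl
  simp only [h2] at h1
  exact_mod_cast h1

/-- There is state transfer at time `t` exactly when row `u` of the unitary matrix `exp(itA)` is a
unit multiple of `e_v`; this is tested on the eigenfunctions. -/
theorem norm_transition_eq_one_iff (X : WGraph V) (t : ℝ) (u v : V) :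
    ‖X.transition t u v‖ = 1 ↔ ∃ γ : ℂ, ‖γ‖ = 1 ∧ ∀ x f, X.IsEigenfunction x f →
      Complex.exp (Complex.I * t * x) * f u = γ * f v := by
  constructor
  · intro h
    refine ⟨X.transition t u v, h, fun x f hf => ?_⟩
    have h0 : ∀ b, b ≠ v → X.transition t u b = 0 := by
      intro b hb
      have hs := X.sum_norm_sq_transition t u
      rw [← Finset.add_sum_erase _ _ (Finset.mem_univ v), h] at hs
      have hz : ∑ b ∈ Finset.univ.erase v, ‖X.transition t u b‖ ^ 2 = 0 := by linarith
      rw [Finset.sum_eq_zero_iff_of_nonneg (fun _ _ => by positivity)] at hz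
      simpa using hz b (by simp [hb])
    rw [← X.sum_transition_mul t x f hf u]
    exact Finset.sum_eq_single v (fun b _ hb => by rw [h0 b hb, zero_mul]) (by simp)
  · rintro ⟨γ, hγ, h⟩
    set y : V → ℂ := fun b => X.transition t u b - if b = v then γ else 0 with hy
    have hy0 : ∀ x f, X.IsEigenfunction x f → ∑ b, (f b : ℂ) * y b = 0 := by
      intro x f hf
      have h1 := X.sum_transition_mul t x f hf u
      rw [h x f hf] at h1
      simp only [hy, mul_sub, Finset.sum_sub_distrib]
      simp [mul_comm (f _ : ℂ), h1]
    have hre : (fun b => (y b).re) = 0 := by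
      apply X.eq_zero_of_forall_isEigenfunction
      intro x f hf
      simpa using congrArg Complex.re (hy0 x f hf)
    have him : (fun b => (y b).im) = 0 := by
      apply X.eq_zero_of_forall_isEigenfunction
      intro x f hf
      simpa using congrArg Complex.im (hy0 x f hf)
    have hv : y v = 0 := Complex.ext (congrFun hre v) (congrFun him v)
    have : X.transition t u v = γ := by
      simpa [hy, sub_eq_zero] using hv
    rw [this, hγ]

theorem norm_exp_I_mul (t x : ℝ) : ‖Complex.exp (Complex.I * t * x)‖ = 1 := by
  rw [show Complex.I * (t : ℂ) * x = ((t * x : ℝ) : ℂ) * Complex.I by push_cast; ring]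
  exact Complex.norm_exp_ofReal_mul_I _

theorem stronglyCospectral_of_norm_transition_eq_one (X : WGraph V) {t : ℝ} {u v : V}
    (ht : ‖X.transition t u v‖ = 1) : X.StronglyCospectral u v := by
  obtain ⟨γ, hγ, h⟩ := (X.norm_transition_eq_one_iff t u v).1 ht
  rw [stronglyCospectral_iff]
  intro x
  by_contra hcon
  push Not at hcon
  obtain ⟨⟨f, hf, hf1⟩, g, hg, hg1⟩ := hcon
  -- The moduli force `|f u| = |f v|` for all eigenfunctions; were the signs for `f` and `g`
  -- different, `f + g` would violate this.
  have habs : ∀ f, X.IsEigenfunction x f → |f u| = |f v| := by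
    intro f hf
    have := congrArg norm (h x f hf)
    simpa [norm_exp_I_mul, hγ] using this
  have h1 := abs_eq_abs.1 (habs f hf)
  have h2 := abs_eq_abs.1 (habs g hg)
  have h3 := abs_eq_abs.1 (habs _ (hf.add hg))
  rcases h1 with h1 | h1
  · exact hf1 h1
  rcases h2 with h2 | h2
  · have hgv : f v ≠ 0 ∧ g v ≠ 0 := by
      refine ⟨fun h0 => hf1 (by rw [h1, h0, neg_zero]), fun h0 => hg1 (by rw [h2, h0, neg_zero])⟩
    rcases h3 with h3 | h3
    · exact hgv.1 (by linarith)
    · exact hgv.2 (by linarith)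
  · exact hg1 h2

/-- State transfer at time `t` means that `u` and `v` are strongly cospectral and that the phases
`exp(itx)` agree on `σ⁺` and are opposite on `σ⁻`; phases are compared with that of `x₀ ∈ σ⁺`. -/
theorem norm_transition_eq_one_iff_stronglyCospectral (X : WGraph V) (t : ℝ) (u v : V) {x₀ : ℝ}
    (hx₀ : x₀ ∈ X.suppPlus u v) :
    ‖X.transition t u v‖ = 1 ↔ X.StronglyCospectral u v ∧
      (∀ x ∈ X.suppPlus u v, ∃ n : ℤ, t * (x₀ - x) = 2 * n * Real.pi) ∧
      ∀ x ∈ X.suppMinus u v, ∃ n : ℤ, t * (x₀ - x) = (2 * n + 1) * Real.pi := by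
  have hplus : ∀ x : ℝ, Complex.exp (Complex.I * t * x₀) = Complex.exp (Complex.I * t * x) ↔
      ∃ n : ℤ, t * (x₀ - x) = 2 * n * Real.pi := by
    intro x
    rw [Complex.exp_eq_exp_iff_exists_int]
    refine exists_congr fun n => ?_
    rw [show Complex.I * (t : ℂ) * x + n * (2 * Real.pi * Complex.I)
      = Complex.I * (t * x + 2 * n * Real.pi) by ring, mul_assoc,
      mul_right_inj' Complex.I_ne_zero]
    norm_cast
    constructor <;> intro h <;> linarith
  have hminus : ∀ x : ℝ, Complex.exp (Complex.I * t * x₀) = -Complex.exp (Complex.I * t * x) ↔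
      ∃ n : ℤ, t * (x₀ - x) = (2 * n + 1) * Real.pi := by
    intro x
    have : -Complex.exp (Complex.I * t * x) = Complex.exp (Complex.I * t * x + Real.pi * Complex.I)
        := by rw [Complex.exp_add, Complex.exp_pi_mul_I]; ring
    rw [this, Complex.exp_eq_exp_iff_exists_int]
    refine exists_congr fun n => ?_
    rw [show Complex.I * (t : ℂ) * x + Real.pi * Complex.I + n * (2 * Real.pi * Complex.I)
      = Complex.I * (t * x + (2 * n + 1) * Real.pi) by ring, mul_assoc,
      mul_right_inj' Complex.I_ne_zero]
    norm_cast
    push_cast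
    constructor <;> intro h <;> linarith
  rw [mem_suppPlus_iff] at hx₀
  obtain ⟨hx₀e, hx₀s⟩ := hx₀
  obtain ⟨f₀, hf₀, hf₀u⟩ := (X.mem_supp_iff _ _).1 hx₀s
  constructor
  · intro ht
    obtain ⟨γ, -, h⟩ := (X.norm_transition_eq_one_iff t u v).1 ht
    have hγ₀ : γ = Complex.exp (Complex.I * t * x₀) := by
      have := h x₀ f₀ hf₀
      rw [← hx₀e f₀ hf₀] at this
      exact (mul_right_cancel₀ (by exact_mod_cast hf₀u) this).symm
    refine ⟨X.stronglyCospectral_of_norm_transition_eq_one ht, ?_, ?_⟩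
    · intro x hx
      rw [mem_suppPlus_iff] at hx
      obtain ⟨f, hf, hfu⟩ := (X.mem_supp_iff _ _).1 hx.2
      have h1 := h x f hf
      rw [← hx.1 f hf] at h1
      rw [← hplus, ← hγ₀]
      exact (mul_right_cancel₀ (by exact_mod_cast hfu) h1).symm
    · intro x hx
      rw [mem_suppMinus_iff] at hx
      obtain ⟨f, hf, hfu⟩ := (X.mem_supp_iff _ _).1 hx.2
      have h1 := h x f hf
      have h2 : f v = - f u := by rw [hx.1 f hf, neg_neg]
      rw [h2] at h1
      rw [← hminus, ← hγ₀]
      apply mul_right_cancel₀ (b := (f u : ℂ)) (by exact_mod_cast hfu)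
      rw [neg_mul, h1]
      push_cast
      ring
  · rintro ⟨hsc, hp, hm⟩
    rw [norm_transition_eq_one_iff]
    refine ⟨Complex.exp (Complex.I * t * x₀), norm_exp_I_mul t x₀, fun x f hf => ?_⟩
    by_cases hs : x ∈ X.supp u
    · have hs' := hs
      rw [hsc.supp_eq] at hs'
      rcases hs' with hs' | hs'
      · rw [(hplus x).2 (hp x hs'), ((X.mem_suppPlus_iff _ _ _).1 hs').1 f hf]
      · rw [(hminus x).2 (hm x hs'), ((X.mem_suppMinus_iff _ _ _).1 hs').1 f hf]
        push_cast
        ring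
    · have hu : f u = 0 := by
        by_contra hu
        exact hs ((X.mem_supp_iff _ _).2 ⟨f, hf, hu⟩)
      have hv : f v = 0 := by
        rcases (X.stronglyCospectral_iff u v).1 hsc x with h | h
        · rw [← h f hf, hu]
        · have := h f hf
          linarith
      simp [hu, hv]

theorem StronglyCospectral.suppMinus_nonempty {X : WGraph V} {u v : V}
    (h : X.StronglyCospectral u v) (huv : u ≠ v) : (X.suppMinus u v).Nonempty := by
  by_contra hne
  have hall : ∀ x f, X.IsEigenfunction x f → f u = f v := by
    intro x f hf
    rcases (X.stronglyCospectral_iff u v).1 h x with h1 | h1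
    · exact h1 f hf
    · have hu : f u = 0 := by
        by_contra hu
        exact hne ⟨x, (X.mem_suppMinus_iff _ _ _).2 ⟨h1, (X.mem_supp_iff _ _).2 ⟨f, hf, hu⟩⟩⟩
      have := h1 f hf
      linarith
  have h0 := X.eq_zero_of_forall_isEigenfunction (Pi.single u 1 - Pi.single v 1) (by
    intro x f hf
    simp [mul_sub, Finset.sum_sub_distrib, Pi.single_apply, hall x f hf])
  have := congrFun h0 u
  simp [huv] at this

end WGraph

/-! ### Eigenfunctions of regular graphs -/

namespace WGraph

variable {V W : Type*}

theorem reachable_iff_of_weight_ne_zero (X : WGraph V) (u : V) {a b : V}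
    (h : X.weight a b ≠ 0) : X.toSimple.Reachable u a ↔ X.toSimple.Reachable u b := by
  by_cases hab : a = b
  · rw [hab]
  · have hadj : X.toSimple.Adj a b := ⟨hab, lt_of_le_of_ne (X.weight_nonneg a b) h.symm⟩
    exact ⟨fun h => h.trans hadj.reachable, fun h => h.trans hadj.symm.reachable⟩

theorem isConnected_of_forall_reachable {X : WGraph V} (u : V)
    (h : ∀ a, X.toSimple.Reachable u a) : X.IsConnected :=
  have : Nonempty V := ⟨u⟩
  ⟨fun a b => (h a).symm.trans (h b)⟩

variable [Fintype V]

open Classical in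
/-- Restricting an eigenfunction to a connected component gives an eigenfunction. -/
theorem IsEigenfunction.restrict_component {X : WGraph V} {x : ℝ} {f : V → ℝ}
    (hf : X.IsEigenfunction x f) (u : V) :
    X.IsEigenfunction x (fun a => if X.toSimple.Reachable u a then f a else 0) := by
  intro a
  have h : ∀ b, X.weight a b * (if X.toSimple.Reachable u b then f b else 0)
      = if X.toSimple.Reachable u a then X.weight a b * f b else 0 := by
    intro b
    by_cases hab : X.weight a b = 0
    · simp [hab]
    · simp [X.reachable_iff_of_weight_ne_zero u hab]
  simp only [h]
  by_cases ha : X.toSimple.Reachable u a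
  · simp [ha, hf a]
  · simp [ha]

theorem IsWeightedRegular.sum_sum_weight_mul {X : WGraph V} {k : ℝ} (hX : X.IsWeightedRegular k)
    (f : V → ℝ) : ∑ a, ∑ b, X.weight a b * f b = k * ∑ b, f b := by
  rw [Finset.sum_comm, Finset.mul_sum]
  refine Finset.sum_congr rfl fun b _ => ?_
  rw [← Finset.sum_mul, ← hX b]
  simp only [X.weight_symm b]

theorem IsWeightedRegular.isEigenfunction_const {X : WGraph V} {k : ℝ}
    (hX : X.IsWeightedRegular k) (c : ℝ) : X.IsEigenfunction k (fun _ => c) := by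
  intro a
  rw [← Finset.sum_mul, hX a]

theorem IsWeightedRegular.sum_eq_zero {X : WGraph V} {k x : ℝ} (hX : X.IsWeightedRegular k)
    {f : V → ℝ} (hf : X.IsEigenfunction x f) (hx : x ≠ k) : ∑ a, f a = 0 := by
  have h := hX.sum_sum_weight_mul f
  simp only [hf _, ← Finset.mul_sum] at h
  have h1 : (x - k) * ∑ a, f a = 0 := by linarith
  exact (mul_eq_zero.1 h1).resolve_left (sub_ne_zero.2 hx)

/-- Centering an eigenfunction of a regular graph gives an eigenfunction: for `x ≠ k` the mean is
zero already, and for `x = k` the constants are eigenfunctions. -/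
theorem IsWeightedRegular.isEigenfunction_sub_mean {X : WGraph V} {k x : ℝ}
    (hX : X.IsWeightedRegular k) {f : V → ℝ} (hf : X.IsEigenfunction x f) :
    X.IsEigenfunction x (fun a => f a + -((∑ b, f b) / Fintype.card V)) := by
  by_cases hx : x = k
  · subst hx
    exact hf.add (hX.isEigenfunction_const _)
  · simpa [hX.sum_eq_zero hf hx] using hf

/-- The quadratic form of the Laplacian `kI - A(X)` on an eigenfunction. -/
theorem IsWeightedRegular.sum_weight_mul_sub_sq {X : WGraph V} {k x : ℝ}
    (hX : X.IsWeightedRegular k) {f : V → ℝ} (hf : X.IsEigenfunction x f) :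
    ∑ a, ∑ b, X.weight a b * (f a - f b) ^ 2 = 2 * (k - x) * ∑ a, f a ^ 2 := by
  have h1 : ∑ a, ∑ b, X.weight a b * f b ^ 2 = k * ∑ b, f b ^ 2 := hX.sum_sum_weight_mul _
  have h2 : ∀ a, ∑ b, X.weight a b * (f a - f b) ^ 2
      = k * f a ^ 2 - 2 * x * f a ^ 2 + ∑ b, X.weight a b * f b ^ 2 := by
    intro a
    have h3 : ∀ b, X.weight a b * (f a - f b) ^ 2 = X.weight a b * f a ^ 2
        - 2 * f a * (X.weight a b * f b) + X.weight a b * f b ^ 2 := fun b => by ring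
    simp only [h3, Finset.sum_add_distrib, Finset.sum_sub_distrib, ← Finset.mul_sum,
      ← Finset.sum_mul, hX a, hf a]
    ring
  simp only [h2, Finset.sum_add_distrib, h1, Finset.sum_sub_distrib, ← Finset.mul_sum]
  ring

theorem IsWeightedRegular.eq_zero_of_lt {X : WGraph V} {k x : ℝ} (hX : X.IsWeightedRegular k)
    {f : V → ℝ} (hf : X.IsEigenfunction x f) (hx : k < x) (a : V) : f a = 0 := by
  have h := hX.sum_weight_mul_sub_sq hf
  have h1 : 0 ≤ ∑ a, ∑ b, X.weight a b * (f a - f b) ^ 2 :=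
    Finset.sum_nonneg fun a _ => Finset.sum_nonneg fun b _ =>
      mul_nonneg (X.weight_nonneg a b) (sq_nonneg _)
  have h2 : 0 ≤ ∑ a, f a ^ 2 := Finset.sum_nonneg fun a _ => sq_nonneg _
  have h3 : ∑ a, f a ^ 2 = 0 := by nlinarith
  have h4 := (Finset.sum_eq_zero_iff_of_nonneg (fun a _ => sq_nonneg (f a))).1 h3 a
    (Finset.mem_univ a)
  simpa using h4

/-- Eigenfunctions for the degree `k` are constant on the connected components. -/
theorem IsWeightedRegular.eq_of_reachable {X : WGraph V} {k : ℝ} (hX : X.IsWeightedRegular k)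
    {f : V → ℝ} (hf : X.IsEigenfunction k f) {a b : V} (hab : X.toSimple.Reachable a b) :
    f a = f b := by
  have h := hX.sum_weight_mul_sub_sq hf
  rw [sub_self, mul_zero, zero_mul] at h
  have hn : ∀ a b, 0 ≤ X.weight a b * (f a - f b) ^ 2 := fun a b =>
    mul_nonneg (X.weight_nonneg a b) (sq_nonneg _)
  have hadj : ∀ a b, X.toSimple.Adj a b → f a = f b := by
    intro a b hab
    have h1 := (Finset.sum_eq_zero_iff_of_nonneg
      (fun a _ => Finset.sum_nonneg fun b _ => hn a b)).1 h a (Finset.mem_univ a)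
    have h2 := (Finset.sum_eq_zero_iff_of_nonneg (fun b _ => hn a b)).1 h1 b (Finset.mem_univ b)
    rcases mul_eq_zero.1 h2 with h3 | h3
    · exact absurd h3 hab.2.ne'
    · exact sub_eq_zero.1 (pow_eq_zero_iff two_ne_zero |>.1 h3)
  obtain ⟨p⟩ := hab
  induction p with
  | nil => rfl
  | cons hd _ ih => exact (hadj _ _ hd).trans ih

/-- `X` is disconnected exactly when, for the degree `k`, there is an eigenfunction of mean zero
that does not vanish at `u`. -/
theorem IsWeightedRegular.not_isConnected_iff {X : WGraph V} {k : ℝ}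
    (hX : X.IsWeightedRegular k) (u : V) :
    ¬ X.IsConnected ↔ ∃ f, X.IsEigenfunction k f ∧ ∑ a, f a = 0 ∧ f u ≠ 0 := by
  classical
  have : Nonempty V := ⟨u⟩
  have hm : (Fintype.card V : ℝ) ≠ 0 := by exact_mod_cast Fintype.card_ne_zero
  constructor
  · intro hc
    have hp := (hX.isEigenfunction_const 1).restrict_component u
    refine ⟨_, hX.isEigenfunction_sub_mean hp, ?_, ?_⟩
    · simp only [Finset.sum_add_distrib, Finset.sum_const, Finset.card_univ, nsmul_eq_mul]
      field_simp
      ring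
    · intro h0
      apply hc
      apply isConnected_of_forall_reachable u
      simp only [SimpleGraph.Reachable.refl, if_true] at h0
      have h1 : ∑ a, (1 - if X.toSimple.Reachable u a then (1 : ℝ) else 0) = 0 := by
        rw [Finset.sum_sub_distrib]
        field_simp at h0
        simp only [Finset.sum_const, Finset.card_univ, nsmul_eq_mul]
        linarith
      intro a
      have h2 := (Finset.sum_eq_zero_iff_of_nonneg (fun a _ => by split_ifs <;> norm_num)).1 h1 a
        (Finset.mem_univ a)
      by_contra ha
      simp [ha] at h2
  · rintro ⟨f, hf, hs, hu⟩ hc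
    have h1 : ∀ a, f a = f u := fun a => hX.eq_of_reachable hf (hc.preconnected a u)
    simp only [h1, Finset.sum_const, Finset.card_univ, nsmul_eq_mul] at hs
    exact (mul_ne_zero hm hu) hs

/-! ### Eigenfunctions of the join -/

variable [Fintype W]

theorem isEigenfunction_join_iff (X : WGraph V) (Y : WGraph W) (x : ℝ) (f : V ⊕ W → ℝ) :
    (X.join Y).IsEigenfunction x f ↔
      (∀ a, ∑ b, X.weight a b * f (Sum.inl b) + ∑ b, f (Sum.inr b) = x * f (Sum.inl a)) ∧
      ∀ a, ∑ b, f (Sum.inl b) + ∑ b, Y.weight a b * f (Sum.inr b) = x * f (Sum.inr a) := by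
  simp only [IsEigenfunction, Sum.forall, Fintype.sum_sum_type, join, one_mul]

section Join

variable {X : WGraph V} {Y : WGraph W} {k l x : ℝ}

theorem IsEigenfunction.sum_inl (hX : X.IsWeightedRegular k) {f : V ⊕ W → ℝ}
    (hf : (X.join Y).IsEigenfunction x f) :
    (x - k) * ∑ a, f (Sum.inl a) = Fintype.card V * ∑ b, f (Sum.inr b) := by
  have h := Finset.sum_congr rfl
    fun a (_ : a ∈ Finset.univ) => ((X.isEigenfunction_join_iff Y x f).1 hf).1 a
  rw [Finset.sum_add_distrib, hX.sum_sum_weight_mul, ← Finset.mul_sum, Finset.sum_const,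
    Finset.card_univ, nsmul_eq_mul] at h
  linarith

theorem IsEigenfunction.sum_inr (hY : Y.IsWeightedRegular l) {f : V ⊕ W → ℝ}
    (hf : (X.join Y).IsEigenfunction x f) :
    (x - l) * ∑ b, f (Sum.inr b) = Fintype.card W * ∑ a, f (Sum.inl a) := by
  have h := Finset.sum_congr rfl
    fun a (_ : a ∈ Finset.univ) => ((X.isEigenfunction_join_iff Y x f).1 hf).2 a
  rw [Finset.sum_add_distrib, hY.sum_sum_weight_mul, ← Finset.mul_sum, Finset.sum_const,
    Finset.card_univ, nsmul_eq_mul] at h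
  linarith

/-- Unless `x` is an eigenvalue of the quotient matrix of the partition `{V, W}`, eigenfunctions
of the join have mean zero on `V` and restrict to eigenfunctions of `X`. -/
theorem IsEigenfunction.inl_of_ne [Nonempty V] (hX : X.IsWeightedRegular k)
    (hY : Y.IsWeightedRegular l) (hx : (x - k) * (x - l) ≠ Fintype.card V * Fintype.card W)
    {f : V ⊕ W → ℝ} (hf : (X.join Y).IsEigenfunction x f) :
    X.IsEigenfunction x (fun a => f (Sum.inl a)) ∧ ∑ a, f (Sum.inl a) = 0 := by
  have h1 := hf.sum_inl hX
  have h2 := hf.sum_inr hY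
  have hm : (Fintype.card V : ℝ) ≠ 0 := by exact_mod_cast Fintype.card_ne_zero
  have h3 : ∑ a, f (Sum.inl a) = 0 := by
    have h4 : ((x - k) * (x - l) - Fintype.card V * Fintype.card W) * ∑ a, f (Sum.inl a) = 0 := by
      linear_combination (x - l) * h1 + (Fintype.card V : ℝ) * h2
    exact (mul_eq_zero.1 h4).resolve_left (sub_ne_zero.2 hx)
  have h5 : ∑ b, f (Sum.inr b) = 0 := by
    rw [h3, mul_zero] at h1
    exact (mul_eq_zero.1 h1.symm).resolve_left hm
  refine ⟨fun a => ?_, h3⟩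
  have := ((X.isEigenfunction_join_iff Y x f).1 hf).1 a
  rwa [h5, add_zero] at this

theorem IsEigenfunction.extend_zero {g : V → ℝ} (hg : X.IsEigenfunction x g)
    (hs : ∑ a, g a = 0) : (X.join Y).IsEigenfunction x (Sum.elim g fun _ => 0) := by
  rw [isEigenfunction_join_iff]
  simp [hs, hg _]

theorem isEigenfunction_join_const (hX : X.IsWeightedRegular k) (hY : Y.IsWeightedRegular l)
    (hx : (x - k) * (x - l) = Fintype.card V * Fintype.card W) :
    (X.join Y).IsEigenfunction x
      (Sum.elim (fun _ => (Fintype.card W : ℝ)) fun _ => x - k) := by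
  rw [isEigenfunction_join_iff]
  simp only [Sum.elim_inl, Sum.elim_inr, ← Finset.sum_mul, hX _, hY _, Finset.sum_const,
    Finset.card_univ, nsmul_eq_mul]
  exact ⟨fun _ => by ring, fun _ => by linear_combination -hx⟩

theorem IsEigenfunction.inl_sub_mean [Nonempty V] (hX : X.IsWeightedRegular k)
    {f : V ⊕ W → ℝ} (hf : (X.join Y).IsEigenfunction x f) :
    X.IsEigenfunction x
      (fun a => f (Sum.inl a) - (∑ b, f (Sum.inl b)) / Fintype.card V) := by
  have h1 := hf.sum_inl hX
  have hm : (Fintype.card V : ℝ) ≠ 0 := by exact_mod_cast Fintype.card_ne_zero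
  intro a
  have h2 := ((X.isEigenfunction_join_iff Y x f).1 hf).1 a
  simp only [mul_sub, Finset.sum_sub_distrib, ← Finset.sum_mul, hX a]
  field_simp
  linear_combination (Fintype.card V : ℝ) * h2 + h1

/-- Eigenfunctions of the join do not separate `u` and `v` iff those of `X` do not. -/
theorem forall_isEigenfunction_join_eq_iff [Nonempty V] (hX : X.IsWeightedRegular k) (u v : V) :
    (∀ f, (X.join Y).IsEigenfunction x f → f (Sum.inl u) = f (Sum.inl v)) ↔
      ∀ g, X.IsEigenfunction x g → g u = g v := by
  have hm : (Fintype.card V : ℝ) ≠ 0 := by exact_mod_cast Fintype.card_ne_zero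
  constructor
  · intro h g hg
    have h0 := h _ ((hX.isEigenfunction_sub_mean hg).extend_zero (by
      simp only [Finset.sum_add_distrib, Finset.sum_const, Finset.card_univ, nsmul_eq_mul]
      field_simp
      ring))
    simpa using h0
  · intro h f hf
    simpa using h _ (hf.inl_sub_mean hX)

theorem not_forall_isEigenfunction_join_eq_neg [Nonempty W] (hX : X.IsWeightedRegular k)
    (hY : Y.IsWeightedRegular l) (hx : (x - k) * (x - l) = Fintype.card V * Fintype.card W)
    (u v : V) :
    ¬ ∀ f, (X.join Y).IsEigenfunction x f → f (Sum.inl u) = -f (Sum.inl v) := by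
  intro h
  have h0 := h _ (isEigenfunction_join_const hX hY hx)
  have hn : (0 : ℝ) < Fintype.card W := by exact_mod_cast Fintype.card_pos
  simp only [Sum.elim_inl] at h0
  linarith

theorem forall_isEigenfunction_join_eq_neg_iff [Nonempty V] (hX : X.IsWeightedRegular k)
    (hY : Y.IsWeightedRegular l) (hx : (x - k) * (x - l) ≠ Fintype.card V * Fintype.card W)
    (hk : x ≠ k) (u v : V) :
    (∀ f, (X.join Y).IsEigenfunction x f → f (Sum.inl u) = -f (Sum.inl v)) ↔
      ∀ g, X.IsEigenfunction x g → g u = -g v := by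
  constructor
  · intro h g hg
    exact h _ (hg.extend_zero (hX.sum_eq_zero hg hk))
  · intro h f hf
    exact h _ (hf.inl_of_ne hX hY hx).1

variable [DecidableEq V] [DecidableEq W]

theorem mem_supp_join_of_quotient [Nonempty W] (hX : X.IsWeightedRegular k)
    (hY : Y.IsWeightedRegular l) (hx : (x - k) * (x - l) = Fintype.card V * Fintype.card W)
    (u : V) : x ∈ (X.join Y).supp (Sum.inl u) := by
  rw [mem_supp_iff]
  refine ⟨_, isEigenfunction_join_const hX hY hx, ?_⟩
  simp

theorem mem_supp_join_iff_of_ne (hX : X.IsWeightedRegular k)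
    (hY : Y.IsWeightedRegular l) (hx : (x - k) * (x - l) ≠ Fintype.card V * Fintype.card W)
    (hk : x ≠ k) (u : V) : x ∈ (X.join Y).supp (Sum.inl u) ↔ x ∈ X.supp u := by
  have : Nonempty V := ⟨u⟩
  rw [mem_supp_iff, mem_supp_iff]
  constructor
  · rintro ⟨f, hf, hfu⟩
    exact ⟨_, (hf.inl_of_ne hX hY hx).1, hfu⟩
  · rintro ⟨g, hg, hgu⟩
    exact ⟨_, hg.extend_zero (hX.sum_eq_zero hg hk), hgu⟩

theorem degree_mem_supp_join_iff [Nonempty W] (hX : X.IsWeightedRegular k)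
    (hY : Y.IsWeightedRegular l) (u : V) :
    k ∈ (X.join Y).supp (Sum.inl u) ↔ ¬ X.IsConnected := by
  have : Nonempty V := ⟨u⟩
  have hk : (k - k) * (k - l) ≠ Fintype.card V * Fintype.card W := by
    rw [sub_self, zero_mul]
    exact_mod_cast (Nat.mul_pos Fintype.card_pos Fintype.card_pos).ne
  rw [hX.not_isConnected_iff u, mem_supp_iff]
  constructor
  · rintro ⟨f, hf, hfu⟩
    exact ⟨_, (hf.inl_of_ne hX hY hk).1, (hf.inl_of_ne hX hY hk).2, hfu⟩
  · rintro ⟨g, hg, hs, hgu⟩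
    exact ⟨_, hg.extend_zero hs, hgu⟩

end Join

end WGraph

/-! ### The eigenvalues `λ⁺` and `λ⁻` of the quotient matrix -/

namespace JoinPST

open WGraph

theorem disc_pos {m n : ℕ} (hm : 0 < m) (hn : 0 < n) (k l : ℤ) : 0 < disc m n k l := by
  unfold disc
  positivity

theorem sq_sqrt_disc (m n : ℕ) (k l : ℤ) :
    Real.sqrt ((disc m n k l : ℤ) : ℝ) ^ 2 = ((k : ℝ) - l) ^ 2 + 4 * m * n := by
  rw [Real.sq_sqrt]
  · simp [disc]
  · have : 0 ≤ disc m n k l := by unfold disc; positivity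
    exact_mod_cast this

theorem quotient_root_iff (m n : ℕ) (k l : ℤ) (x : ℝ) :
    (x - k) * (x - l) = m * n ↔ x = lamPlus m n k l ∨ x = lamMinus m n k l := by
  have h := sq_sqrt_disc m n k l
  have h1 : (x - k) * (x - l) - m * n = (x - lamPlus m n k l) * (x - lamMinus m n k l) := by
    unfold lamPlus lamMinus
    linear_combination (1 / 4 : ℝ) * h
  rw [← sub_eq_zero, h1, mul_eq_zero, sub_eq_zero, sub_eq_zero]

theorem lamPlus_root (m n : ℕ) (k l : ℤ) :
    (lamPlus m n k l - k) * (lamPlus m n k l - l) = m * n :=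
  (quotient_root_iff m n k l _).2 (Or.inl rfl)

theorem lamMinus_root (m n : ℕ) (k l : ℤ) :
    (lamMinus m n k l - k) * (lamMinus m n k l - l) = m * n :=
  (quotient_root_iff m n k l _).2 (Or.inr rfl)

theorem degree_not_root {m n : ℕ} (hm : 0 < m) (hn : 0 < n) (k l : ℤ) :
    ((k : ℝ) - k) * ((k : ℝ) - l) ≠ m * n := by
  rw [sub_self, zero_mul]
  exact_mod_cast (Nat.mul_pos hm hn).ne

theorem degree_lt_lamPlus {m n : ℕ} (hm : 0 < m) (hn : 0 < n) (k l : ℤ) :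
    (k : ℝ) < lamPlus m n k l := by
  have h : ((k : ℝ) - l) < Real.sqrt ((disc m n k l : ℤ) : ℝ) := by
    apply Real.lt_sqrt_of_sq_lt
    have : (k - l) ^ 2 < disc m n k l := by
      unfold disc
      have : (0 : ℤ) < 4 * m * n := by positivity
      linarith
    exact_mod_cast this
  unfold lamPlus
  linarith

theorem lamPlus_sub_lamMinus (m n : ℕ) (k l : ℤ) :
    lamPlus m n k l - lamMinus m n k l = Real.sqrt ((disc m n k l : ℤ) : ℝ) := by
  unfold lamPlus lamMinus
  ring

/-! ### Strong cospectrality in the join -/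

variable {V W : Type*} [Fintype V]

theorem isEigenfunction_iff_of_isO2 {X : WGraph V} {k : ℝ} (h : X.IsO2 k) (x : ℝ) (f : V → ℝ) :
    X.IsEigenfunction x f ↔ ∀ a, k * f a = x * f a := by
  refine forall_congr' fun a => ?_
  rw [Finset.sum_eq_single a (fun b _ hb => by rw [h.2.2 a b hb.symm, zero_mul]) (by simp),
    h.2.1 a]

theorem eq_zero_of_isO2 {X : WGraph V} {k : ℝ} (h : X.IsO2 k) {x : ℝ} (hx : x ≠ k) {f : V → ℝ}
    (hf : X.IsEigenfunction x f) (a : V) : f a = 0 := by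
  have h1 := (isEigenfunction_iff_of_isO2 h x f).1 hf a
  have h2 : (x - k) * f a = 0 := by linarith
  exact (mul_eq_zero.1 h2).resolve_left (sub_ne_zero.2 hx)

theorem eq_or_eq_of_card_eq_two (h : Fintype.card V = 2) {u v : V} (huv : u ≠ v) (a : V) :
    a = u ∨ a = v := by
  classical
  have h1 : ({u, v} : Finset V) = Finset.univ :=
    Finset.eq_univ_of_card _ (by rw [Finset.card_pair huv, h])
  have := Finset.mem_univ a
  rw [← h1] at this
  simpa using this

theorem sum_eq_add_of_card_eq_two (h : Fintype.card V = 2) {u v : V} (huv : u ≠ v)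
    (f : V → ℝ) : ∑ a, f a = f u + f v := by
  classical
  have h1 : ({u, v} : Finset V) = Finset.univ :=
    Finset.eq_univ_of_card _ (by rw [Finset.card_pair huv, h])
  rw [← h1, Finset.sum_pair huv]

variable [DecidableEq V]

/-- A vertex on which all eigenfunctions for `x ≠ k` vanish is isolated up to a loop of weight
`k`: its characteristic vector is an eigenfunction for `k`. -/
theorem weight_eq_of_forall_isEigenfunction_eq_zero (X : WGraph V) (k : ℝ) (u : V)
    (h : ∀ x f, x ≠ k → X.IsEigenfunction x f → f u = 0) (a : V) :
    X.weight u a = if a = u then k else 0 := by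
  have h0 := X.eq_zero_of_forall_isEigenfunction
    (fun a => X.weight u a - if a = u then k else 0) (by
      intro x f hf
      have h1 := hf u
      simp only [mul_sub, Finset.sum_sub_distrib, mul_ite, mul_zero, Finset.sum_ite_eq',
        Finset.mem_univ, if_true]
      simp only [mul_comm (f _) (X.weight _ _), h1]
      by_cases hx : x = k
      · rw [hx]; ring
      · rw [h x f hx hf]; ring)
  have := congrFun h0 a
  simpa [sub_eq_zero] using this

theorem lamPlus_not_mem_supp {X : WGraph V} {k l : ℤ} (hX : X.IsWeightedRegular (k : ℝ)) {n : ℕ}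
    (hn : 0 < n) (u : V) : lamPlus (Fintype.card V) n k l ∉ X.supp u := by
  have : Nonempty V := ⟨u⟩
  rw [mem_supp_iff]
  rintro ⟨f, hf, hfu⟩
  exact hfu (hX.eq_zero_of_lt hf (degree_lt_lamPlus Fintype.card_pos hn k l) u)

/-- In a strongly cospectral pair of `X` the eigenfunctions for the degree do not separate the
two vertices, as the constant function excludes the negative sign. -/
theorem eq_of_stronglyCospectral_degree {X : WGraph V} {k : ℝ} (hX : X.IsWeightedRegular k)
    {u v : V} (hsc : X.StronglyCospectral u v) :
    ∀ g, X.IsEigenfunction k g → g u = g v := by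
  refine ((X.stronglyCospectral_iff u v).1 hsc k).resolve_right fun h => ?_
  have := h _ (hX.isEigenfunction_const 1)
  norm_num at this

theorem not_mem_suppMinus_of_root {X : WGraph V} {k l : ℤ} (hX : X.IsWeightedRegular (k : ℝ))
    {n : ℕ} (hn : 0 < n) {u v : V}
    (hlam : lamMinus (Fintype.card V) n k l ∉ X.suppMinus u v) {x : ℝ}
    (hr : (x - k) * (x - l) = Fintype.card V * n) : x ∉ X.suppMinus u v := by
  rcases (quotient_root_iff _ _ k l x).1 hr with rfl | rfl
  · exact fun h => lamPlus_not_mem_supp hX hn u ((X.mem_suppMinus_iff _ u v).1 h).2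
  · exact hlam

theorem eq_of_stronglyCospectral_root {X : WGraph V} {k l : ℤ}
    (hX : X.IsWeightedRegular (k : ℝ)) {n : ℕ} (hn : 0 < n) {u v : V}
    (hsc : X.StronglyCospectral u v)
    (hlam : lamMinus (Fintype.card V) n k l ∉ X.suppMinus u v) {x : ℝ}
    (hr : (x - k) * (x - l) = Fintype.card V * n) :
    ∀ g, X.IsEigenfunction x g → g u = g v := by
  rcases (X.stronglyCospectral_iff u v).1 hsc x with h | h
  · exact h
  · intro g hg
    have hu : g u = 0 := by
      by_contra hu
      exact not_mem_suppMinus_of_root hX hn hlam hr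
        ((X.mem_suppMinus_iff x u v).2 ⟨h, (X.mem_supp_iff x u).2 ⟨g, hg, hu⟩⟩)
    have := h g hg
    linarith

variable [Fintype W] [DecidableEq W] [Nonempty W] {X : WGraph V} {Y : WGraph W} {k l : ℤ}

/-- If `u` and `v` are strongly cospectral in the join but eigenfunctions of `X` for its degree
separate them, then `u` and `v` lie in different components of `X`, which forces `X = O₂(k)`. -/
theorem isO2_of_stronglyCospectral_join (hX : X.IsWeightedRegular (k : ℝ))
    (hY : Y.IsWeightedRegular (l : ℝ)) {u v : V} (huv : u ≠ v)
    (hsc : (X.join Y).StronglyCospectral (Sum.inl u) (Sum.inl v))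
    (hk : ¬ ∀ g, X.IsEigenfunction (k : ℝ) g → g u = g v) : X.IsO2 (k : ℝ) := by
  classical
  have : Nonempty V := ⟨u⟩
  have hm : (Fintype.card V : ℝ) ≠ 0 := by exact_mod_cast Fintype.card_ne_zero
  rw [stronglyCospectral_iff] at hsc
  have hreach : ¬ X.toSimple.Reachable u v := fun h =>
    hk fun g hg => hX.eq_of_reachable hg h
  have hrel : ∀ x, x ≠ (k : ℝ) → (∀ g, X.IsEigenfunction x g → g u = g v) ∨
      ∀ g, X.IsEigenfunction x g → g u = -g v := by
    intro x hx
    rcases hsc x with h | h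
    · exact Or.inl ((forall_isEigenfunction_join_eq_iff hX u v).1 h)
    · by_cases hr : (x - k) * (x - l) = Fintype.card V * Fintype.card W
      · exact absurd h (not_forall_isEigenfunction_join_eq_neg hX hY hr u v)
      · exact Or.inr ((forall_isEigenfunction_join_eq_neg_iff hX hY hr hx u v).1 h)
  have hu0 : ∀ x f, x ≠ (k : ℝ) → X.IsEigenfunction x f → f u = 0 := by
    intro x f hx hf
    have hg := hf.restrict_component u
    rcases hrel x hx with h | h <;> simpa [hreach] using h _ hg
  have hv0 : ∀ x f, x ≠ (k : ℝ) → X.IsEigenfunction x f → f v = 0 := by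
    intro x f hx hf
    have hg := hf.restrict_component v
    have hreach' : ¬ X.toSimple.Reachable v u := fun h => hreach h.symm
    rcases hrel x hx with h | h
    · simpa [hreach'] using (h _ hg).symm
    · simpa [hreach'] using h _ hg
  have hwu := weight_eq_of_forall_isEigenfunction_eq_zero X k u hu0
  have hwv := weight_eq_of_forall_isEigenfunction_eq_zero X k v hv0
  have heu : X.IsEigenfunction (k : ℝ) (fun a => if a = u then 1 else 0) := by
    intro a
    simp [X.weight_symm a u, hwu]
  have hopp := (hsc k).resolve_left fun h =>
    hk ((forall_isEigenfunction_join_eq_iff hX u v).1 h)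
  have hcard : Fintype.card V = 2 := by
    have h1 := hopp _ ((hX.isEigenfunction_sub_mean heu).extend_zero (by
      simp only [Finset.sum_add_distrib, Finset.sum_const, Finset.card_univ, nsmul_eq_mul]
      field_simp
      ring))
    simp only [Sum.elim_inl, if_true, huv.symm, if_false, Finset.sum_ite_eq', Finset.mem_univ]
      at h1
    field_simp at h1
    have h2 : (Fintype.card V : ℝ) = 2 := by linarith
    exact_mod_cast h2
  refine ⟨hcard, fun a => ?_, fun a b hab => ?_⟩
  · rcases eq_or_eq_of_card_eq_two hcard huv a with rfl | rfl
    · simp [hwu]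
    · simp [hwv]
  · rcases eq_or_eq_of_card_eq_two hcard huv a with rfl | rfl
    · simp [hwu, hab.symm]
    · simp [hwv, hab.symm]

/-- Condition (i) for strong cospectrality in the join, away from the exceptional graph. -/
theorem stronglyCospectral_of_join (hX : X.IsWeightedRegular (k : ℝ))
    (hY : Y.IsWeightedRegular (l : ℝ)) {u v : V} (huv : u ≠ v)
    (hsc : (X.join Y).StronglyCospectral (Sum.inl u) (Sum.inl v)) (hO : ¬ X.IsO2 (k : ℝ)) :
    X.StronglyCospectral u v ∧
      lamMinus (Fintype.card V) (Fintype.card W) k l ∉ X.suppMinus u v := by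
  have : Nonempty V := ⟨u⟩
  have hk : ∀ g, X.IsEigenfunction (k : ℝ) g → g u = g v := by
    by_contra hk
    exact hO (isO2_of_stronglyCospectral_join hX hY huv hsc hk)
  rw [stronglyCospectral_iff] at hsc
  have hroot : ∀ x : ℝ, (x - k) * (x - l) = Fintype.card V * Fintype.card W →
      ∀ g, X.IsEigenfunction x g → g u = g v := fun x hr =>
    (forall_isEigenfunction_join_eq_iff hX u v).1
      ((hsc x).resolve_right (not_forall_isEigenfunction_join_eq_neg hX hY hr u v))
  refine ⟨(X.stronglyCospectral_iff u v).2 fun x => ?_, fun hmem => ?_⟩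
  · by_cases hxk : x = k
    · exact Or.inl (hxk ▸ hk)
    by_cases hr : (x - k) * (x - l) = Fintype.card V * Fintype.card W
    · exact Or.inl (hroot x hr)
    · exact (hsc x).imp (forall_isEigenfunction_join_eq_iff hX u v).1
        (forall_isEigenfunction_join_eq_neg_iff hX hY hr hxk u v).1
  · exact not_mem_suppPlus_of_mem_suppMinus hmem ((X.mem_suppPlus_iff _ u v).2
      ⟨hroot _ (lamMinus_root _ _ k l), ((X.mem_suppMinus_iff _ u v).1 hmem).2⟩)

theorem stronglyCospectral_join (hX : X.IsWeightedRegular (k : ℝ))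
    (hY : Y.IsWeightedRegular (l : ℝ)) {u v : V} (hsc : X.StronglyCospectral u v)
    (hlam : lamMinus (Fintype.card V) (Fintype.card W) k l ∉ X.suppMinus u v) :
    (X.join Y).StronglyCospectral (Sum.inl u) (Sum.inl v) := by
  have : Nonempty V := ⟨u⟩
  rw [stronglyCospectral_iff]
  intro x
  rw [forall_isEigenfunction_join_eq_iff hX u v]
  by_cases hr : (x - k) * (x - l) = Fintype.card V * Fintype.card W
  · exact Or.inl (eq_of_stronglyCospectral_root hX Fintype.card_pos hsc hlam hr)
  by_cases hxk : x = k
  · exact Or.inl (hxk ▸ eq_of_stronglyCospectral_degree hX hsc)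
  · rw [forall_isEigenfunction_join_eq_neg_iff hX hY hr hxk]
    exact (X.stronglyCospectral_iff u v).1 hsc x

theorem stronglyCospectral_join_of_isO2 (hX : X.IsWeightedRegular (k : ℝ))
    (hY : Y.IsWeightedRegular (l : ℝ)) {u v : V} (huv : u ≠ v) (hO : X.IsO2 (k : ℝ)) :
    (X.join Y).StronglyCospectral (Sum.inl u) (Sum.inl v) := by
  have : Nonempty V := ⟨u⟩
  rw [stronglyCospectral_iff]
  intro x
  by_cases hxk : x = k
  · right
    intro f hf
    have h := (hf.inl_of_ne hX hY (hxk ▸ degree_not_root Fintype.card_pos Fintype.card_pos k l)).2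
    rw [sum_eq_add_of_card_eq_two hO.1 huv] at h
    linarith
  · left
    rw [forall_isEigenfunction_join_eq_iff hX u v]
    intro g hg
    rw [eq_zero_of_isO2 hO hxk hg, eq_zero_of_isO2 hO hxk hg]

theorem stronglyCospectral_join_iff (hX : X.IsWeightedRegular (k : ℝ))
    (hY : Y.IsWeightedRegular (l : ℝ)) {u v : V} (huv : u ≠ v) :
    (X.join Y).StronglyCospectral (Sum.inl u) (Sum.inl v) ↔
      (X.StronglyCospectral u v ∧
        lamMinus (Fintype.card V) (Fintype.card W) k l ∉ X.suppMinus u v) ∨ X.IsO2 (k : ℝ) := by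
  constructor
  · intro hsc
    by_cases hO : X.IsO2 (k : ℝ)
    · exact Or.inr hO
    · exact Or.inl (stronglyCospectral_of_join hX hY huv hsc hO)
  · rintro (h | h)
    · exact stronglyCospectral_join hX hY h.1 h.2
    · exact stronglyCospectral_join_of_isO2 hX hY huv h

/-! ### The eigenvalue support in the join -/

theorem mem_supp_join_iff (hX : X.IsWeightedRegular (k : ℝ)) (hY : Y.IsWeightedRegular (l : ℝ))
    (u : V) (x : ℝ) : x ∈ (X.join Y).supp (Sum.inl u) ↔
      x ∈ (X.supp u \ {(k : ℝ)}) ∪ extra X (Fintype.card W) k l := by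
  have : Nonempty V := ⟨u⟩
  have hkr := degree_not_root (m := Fintype.card V) (n := Fintype.card W)
    Fintype.card_pos Fintype.card_pos k l
  simp only [Set.mem_union, Set.mem_sdiff, Set.mem_singleton_iff, extra, Set.mem_ofPred_eq,
    ← or_assoc, ← quotient_root_iff]
  by_cases hr : (x - k) * (x - l) = Fintype.card V * Fintype.card W
  · simp [hr, mem_supp_join_of_quotient hX hY hr]
  by_cases hxk : x = k
  · subst hxk
    simp [degree_mem_supp_join_iff hX hY u, hkr, -sub_self]
  · simp [hr, hxk, mem_supp_join_iff_of_ne hX hY hr hxk]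

theorem extra_subset_supp_join (hX : X.IsWeightedRegular (k : ℝ))
    (hY : Y.IsWeightedRegular (l : ℝ)) (u : V) :
    extra X (Fintype.card W) k l ⊆ (X.join Y).supp (Sum.inl u) := fun x hx =>
  (mem_supp_join_iff hX hY u x).2 (Or.inr hx)

theorem supp_join_sdiff_union_extra (hX : X.IsWeightedRegular (k : ℝ))
    (hY : Y.IsWeightedRegular (l : ℝ)) (u : V) :
    ((X.join Y).supp (Sum.inl u) \ {(k : ℝ)}) ∪ extra X (Fintype.card W) k l
      = (X.join Y).supp (Sum.inl u) := by
  apply Set.Subset.antisymm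
  · exact Set.union_subset Set.sdiff_subset (extra_subset_supp_join hX hY u)
  · intro x hx
    have := (mem_supp_join_iff hX hY u x).1 hx
    simp only [Set.mem_union, Set.mem_sdiff] at this ⊢
    tauto

theorem mem_suppPlus_join_of_root (hX : X.IsWeightedRegular (k : ℝ))
    (hY : Y.IsWeightedRegular (l : ℝ)) {u v : V}
    (hsc : (X.join Y).StronglyCospectral (Sum.inl u) (Sum.inl v)) {x : ℝ}
    (hr : (x - k) * (x - l) = Fintype.card V * Fintype.card W) :
    x ∈ (X.join Y).suppPlus (Sum.inl u) (Sum.inl v) := by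
  refine (mem_suppPlus_iff _ _ _ _).2 ⟨?_, mem_supp_join_of_quotient hX hY hr u⟩
  exact (((X.join Y).stronglyCospectral_iff _ _).1 hsc x).resolve_right
    (not_forall_isEigenfunction_join_eq_neg hX hY hr u v)

/-- A strongly cospectral pair of the join that comes from one of `X` has negative support equal
to that in `X`. -/
theorem suppMinus_join (hX : X.IsWeightedRegular (k : ℝ))
    (hY : Y.IsWeightedRegular (l : ℝ)) {u v : V} (hsc : X.StronglyCospectral u v)
    (hlam : lamMinus (Fintype.card V) (Fintype.card W) k l ∉ X.suppMinus u v) :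
    (X.join Y).suppMinus (Sum.inl u) (Sum.inl v) = X.suppMinus u v := by
  have : Nonempty V := ⟨u⟩
  have hscj := stronglyCospectral_join hX hY hsc hlam
  ext x
  by_cases hr : (x - k) * (x - l) = Fintype.card V * Fintype.card W
  · refine iff_of_false (fun h => ?_) (not_mem_suppMinus_of_root hX Fintype.card_pos hlam hr)
    exact not_mem_suppPlus_of_mem_suppMinus h (mem_suppPlus_join_of_root hX hY hscj hr)
  by_cases hxk : x = k
  · have hag := eq_of_stronglyCospectral_degree hX hsc
    refine iff_of_false (fun h => ?_) (fun h => ?_)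
    · refine not_mem_suppPlus_of_mem_suppMinus h ((mem_suppPlus_iff _ _ _ _).2
        ⟨?_, ((mem_suppMinus_iff _ _ _ _).1 h).2⟩)
      rw [forall_isEigenfunction_join_eq_iff hX u v, hxk]
      exact hag
    · refine not_mem_suppPlus_of_mem_suppMinus h ((mem_suppPlus_iff _ _ _ _).2
        ⟨hxk ▸ hag, ((mem_suppMinus_iff _ _ _ _).1 h).2⟩)
  · rw [mem_suppMinus_iff, mem_suppMinus_iff, mem_supp_join_iff_of_ne hX hY hr hxk,
      forall_isEigenfunction_join_eq_neg_iff hX hY hr hxk]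

theorem suppPlus_join (hX : X.IsWeightedRegular (k : ℝ))
    (hY : Y.IsWeightedRegular (l : ℝ)) {u v : V} (hsc : X.StronglyCospectral u v)
    (hlam : lamMinus (Fintype.card V) (Fintype.card W) k l ∉ X.suppMinus u v) :
    (X.join Y).suppPlus (Sum.inl u) (Sum.inl v)
      = (X.suppPlus u v \ {(k : ℝ)}) ∪ extra X (Fintype.card W) k l := by
  have : Nonempty V := ⟨u⟩
  have hscj := stronglyCospectral_join hX hY hsc hlam
  ext x
  rw [mem_suppPlus_iff, forall_isEigenfunction_join_eq_iff hX u v, mem_supp_join_iff hX hY,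
    Set.mem_union, Set.mem_union, Set.mem_sdiff, Set.mem_sdiff, mem_suppPlus_iff]
  have hex : x ∈ extra X (Fintype.card W) k l → ∀ g, X.IsEigenfunction x g → g u = g v := by
    simp only [extra, Set.mem_ofPred_eq, ← or_assoc, ← quotient_root_iff]
    rintro (hr | ⟨-, hxk⟩)
    · exact eq_of_stronglyCospectral_root hX Fintype.card_pos hsc hlam hr
    · exact hxk ▸ eq_of_stronglyCospectral_degree hX hsc
  tauto

theorem suppMinus_join_of_isO2 (hX : X.IsWeightedRegular (k : ℝ))
    (hY : Y.IsWeightedRegular (l : ℝ)) {u v : V} (huv : u ≠ v) (hO : X.IsO2 (k : ℝ)) :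
    (X.join Y).suppMinus (Sum.inl u) (Sum.inl v) = {(k : ℝ)} := by
  have : Nonempty V := ⟨u⟩
  have hscj := stronglyCospectral_join_of_isO2 hX hY huv hO
  have hsub : (X.join Y).suppMinus (Sum.inl u) (Sum.inl v) ⊆ {(k : ℝ)} := by
    intro x hx
    by_contra hxk
    refine not_mem_suppPlus_of_mem_suppMinus hx ((mem_suppPlus_iff _ _ _ _).2
        ⟨?_, ((mem_suppMinus_iff _ _ _ _).1 hx).2⟩)
    rw [forall_isEigenfunction_join_eq_iff hX u v]
    intro g hg
    rw [eq_zero_of_isO2 hO hxk hg, eq_zero_of_isO2 hO hxk hg]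
  have hne := hscj.suppMinus_nonempty (Sum.inl_injective.ne huv)
  exact (Set.subset_singleton_iff_eq.1 hsub).resolve_left hne.ne_empty

theorem suppPlus_join_of_isO2 (hX : X.IsWeightedRegular (k : ℝ))
    (hY : Y.IsWeightedRegular (l : ℝ)) {u v : V} (huv : u ≠ v) (hO : X.IsO2 (k : ℝ)) :
    (X.join Y).suppPlus (Sum.inl u) (Sum.inl v) =
      {lamPlus (Fintype.card V) (Fintype.card W) k l,
        lamMinus (Fintype.card V) (Fintype.card W) k l} := by
  have : Nonempty V := ⟨u⟩
  have hscj := stronglyCospectral_join_of_isO2 hX hY huv hO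
  ext x
  rw [Set.mem_insert_iff, Set.mem_singleton_iff, ← quotient_root_iff]
  refine ⟨fun hx => ?_, mem_suppPlus_join_of_root hX hY hscj⟩
  by_contra hr
  have hs := ((mem_suppPlus_iff _ _ _ _).1 hx).2
  by_cases hxk : x = k
  · have : x ∈ (X.join Y).suppMinus (Sum.inl u) (Sum.inl v) := by
      rw [suppMinus_join_of_isO2 hX hY huv hO, hxk, Set.mem_singleton_iff]
    exact not_mem_suppPlus_of_mem_suppMinus this hx
  · rw [mem_supp_join_iff_of_ne hX hY hr hxk, mem_supp_iff] at hs
    obtain ⟨f, hf, hfu⟩ := hs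
    exact hfu (eq_zero_of_isO2 hO hxk hf u)

theorem suppPlus_join_eq_augPlus (hX : X.IsWeightedRegular (k : ℝ))
    (hY : Y.IsWeightedRegular (l : ℝ)) {u v : V} (huv : u ≠ v)
    (hsc : (X.join Y).StronglyCospectral (Sum.inl u) (Sum.inl v)) :
    (X.join Y).suppPlus (Sum.inl u) (Sum.inl v) = augPlus X (Fintype.card W) k l u v := by
  unfold augPlus
  split_ifs with hO
  · exact suppPlus_join_of_isO2 hX hY huv hO
  · have h := stronglyCospectral_of_join hX hY huv hsc hO
    exact suppPlus_join hX hY h.1 h.2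

theorem suppMinus_join_eq_augMinus (hX : X.IsWeightedRegular (k : ℝ))
    (hY : Y.IsWeightedRegular (l : ℝ)) {u v : V} (huv : u ≠ v)
    (hsc : (X.join Y).StronglyCospectral (Sum.inl u) (Sum.inl v)) :
    (X.join Y).suppMinus (Sum.inl u) (Sum.inl v) = augMinus X k u v := by
  unfold augMinus
  split_ifs with hO
  · exact suppMinus_join_of_isO2 hX hY huv hO
  · have h := stronglyCospectral_of_join hX hY huv hsc hO
    exact suppMinus_join hX hY h.1 h.2

end JoinPST

/-! ### Times of equal and opposite phases -/

namespace JoinPST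

open WGraph

/-- At time `t` the phases `exp(itx)` for `x ∈ P` equal that of `x₀`, and those for `x ∈ N` are
opposite to it. -/
def IsPhaseTime (P N : Set ℝ) (x₀ t : ℝ) : Prop :=
  (∀ x ∈ P, ∃ n : ℤ, t * (x₀ - x) = 2 * n * Real.pi) ∧
    ∀ x ∈ N, ∃ n : ℤ, t * (x₀ - x) = (2 * n + 1) * Real.pi

theorem IsPhaseTime.exists_int {P N : Set ℝ} {x₀ t : ℝ} (ht : IsPhaseTime P N x₀ t) {x : ℝ}
    (hx : x ∈ P ∪ N) : ∃ n : ℤ, t * (x₀ - x) = n * Real.pi := by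
  rcases hx with hx | hx
  · obtain ⟨n, hn⟩ := ht.1 x hx
    exact ⟨2 * n, by push_cast; exact hn⟩
  · obtain ⟨n, hn⟩ := ht.2 x hx
    exact ⟨2 * n + 1, by push_cast; exact hn⟩

/-- Given a phase time, ratios of eigenvalue differences are rational. -/
theorem IsPhaseTime.exists_rat {P N : Set ℝ} {x₀ y₀ t : ℝ} (ht : IsPhaseTime P N x₀ t)
    (hN : N.Nonempty) (hy₀ : y₀ ∈ P ∪ N) (hne : y₀ ≠ x₀) {x : ℝ} (hx : x ∈ P ∪ N) :
    ∃ q : ℚ, x₀ - x = q * (x₀ - y₀) := by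
  have hpi := Real.pi_pos
  have ht0 : t ≠ 0 := by
    rintro rfl
    obtain ⟨μ, hμ⟩ := hN
    obtain ⟨n, hn⟩ := ht.2 μ hμ
    rw [zero_mul] at hn
    have h1 := (mul_eq_zero.1 hn.symm).resolve_right hpi.ne'
    have h2 : 2 * n + 1 = 0 := by exact_mod_cast h1
    omega
  obtain ⟨n, hn⟩ := ht.exists_int hx
  obtain ⟨n₀, hn₀⟩ := ht.exists_int hy₀
  have hsub : x₀ - y₀ ≠ 0 := sub_ne_zero.2 hne.symm
  have hn₀0 : (n₀ : ℝ) ≠ 0 := by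
    intro h
    rw [h, zero_mul] at hn₀
    exact (mul_ne_zero ht0 hsub) hn₀
  refine ⟨n / n₀, ?_⟩
  push_cast
  apply mul_left_cancel₀ ht0
  rw [hn, mul_left_comm, hn₀]
  field_simp

theorem emultiplicity_two_odd (j : ℤ) : emultiplicity (2 : ℤ) (2 * j + 1) = 0 :=
  emultiplicity_eq_zero.2 (by omega)

theorem odd_mul_ne_zero {s : ℝ} {b j : ℤ} (h : s * b = 2 * j + 1) : b ≠ 0 := by
  rintro rfl
  rw [Int.cast_zero, mul_zero] at h
  have : (0 : ℤ) = 2 * j + 1 := by exact_mod_cast h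
  omega

/-- If `s a` is an even and `s b` an odd integer, then `ν₂(a) > ν₂(b)`. -/
theorem emultiplicity_lt_of_even_of_odd {s : ℝ} {a b i j : ℤ} (ha : s * a = 2 * i)
    (hb : s * b = 2 * j + 1) : emultiplicity (2 : ℤ) b < emultiplicity (2 : ℤ) a := by
  have h : a * (2 * j + 1) = b * (2 * i) := by
    have : (a : ℝ) * (2 * j + 1) = b * (2 * i) := by rw [← ha, ← hb]; ring
    exact_mod_cast this
  have hfin : FiniteMultiplicity (2 : ℤ) b :=
    Int.finiteMultiplicity_iff.2 ⟨by norm_num, odd_mul_ne_zero hb⟩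
  have h1 := congrArg (emultiplicity (2 : ℤ)) h
  rw [emultiplicity_mul Int.prime_two, emultiplicity_mul Int.prime_two,
    emultiplicity_mul Int.prime_two, emultiplicity_two_odd, add_zero] at h1
  have h2 : emultiplicity (2 : ℤ) 2 = 1 :=
    (Int.finiteMultiplicity_iff.2 ⟨by norm_num, by norm_num⟩).emultiplicity_self
  rw [h1, h2]
  have h3 : emultiplicity (2 : ℤ) b ≠ ⊤ := (emultiplicity_lt_top.2 hfin).ne
  exact (ENat.lt_add_one_iff h3).2 le_rfl |>.trans_le
    (add_le_add_right (le_self_add (a := (1 : ℕ∞))) _)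

theorem emultiplicity_eq_of_odd_of_odd {s : ℝ} {b c j j' : ℤ} (hb : s * b = 2 * j + 1)
    (hc : s * c = 2 * j' + 1) : emultiplicity (2 : ℤ) b = emultiplicity (2 : ℤ) c := by
  have h : b * (2 * j' + 1) = c * (2 * j + 1) := by
    have : (b : ℝ) * (2 * j' + 1) = c * (2 * j + 1) := by rw [← hb, ← hc]; ring
    exact_mod_cast this
  have h1 := congrArg (emultiplicity (2 : ℤ)) h
  rwa [emultiplicity_mul Int.prime_two, emultiplicity_mul Int.prime_two, emultiplicity_two_odd,
    emultiplicity_two_odd, add_zero, add_zero] at h1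

theorem IsPhaseTime.valuationCondition {P N : Set ℝ} {x₀ t : ℝ} (ht : IsPhaseTime P N x₀ t)
    {Δ : ℕ} (hΔ : 0 < Δ)
    (hint : ∀ x ∈ P ∪ N, ∀ y ∈ P ∪ N, ∃ z : ℤ, (x - y) / Real.sqrt (Δ : ℝ) = z) :
    ValuationCondition P N Δ := by
  have hd : 0 < Real.sqrt (Δ : ℝ) := Real.sqrt_pos.2 (by exact_mod_cast hΔ)
  have hpi := Real.pi_pos
  intro x hx y hy z hz w hw
  obtain ⟨a, ha⟩ := hint x (Or.inl hx) y (Or.inl hy)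
  obtain ⟨b, hb⟩ := hint x (Or.inl hx) z (Or.inr hz)
  obtain ⟨c, hc⟩ := hint x (Or.inl hx) w (Or.inr hw)
  obtain ⟨nx, hnx⟩ := ht.1 x hx
  obtain ⟨ny, hny⟩ := ht.1 y hy
  obtain ⟨nz, hnz⟩ := ht.2 z hz
  obtain ⟨nw, hnw⟩ := ht.2 w hw
  have ha' : t * Real.sqrt Δ / Real.pi * a = 2 * (ny - nx : ℤ) := by
    rw [← ha]
    push_cast
    field_simp
    linear_combination hny - hnx
  have hb' : t * Real.sqrt Δ / Real.pi * b = 2 * (nz - nx : ℤ) + 1 := by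
    rw [← hb]
    push_cast
    field_simp
    linear_combination hnz - hnx
  have hc' : t * Real.sqrt Δ / Real.pi * c = 2 * (nw - nx : ℤ) + 1 := by
    rw [← hc]
    push_cast
    field_simp
    linear_combination hnw - hnx
  exact ⟨a, b, c, ha, hb, hc, emultiplicity_lt_of_even_of_odd ha' hb',
    emultiplicity_eq_of_odd_of_odd hb' hc'⟩

/-- If `e` is the common 2-adic valuation of the differences between `P` and `N`, divided by `√Δ`,
then `π / (2 ^ e √Δ)` is a phase time. -/
theorem ValuationCondition.exists_isPhaseTime {P N : Set ℝ} {Δ : ℕ}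
    (h : ValuationCondition P N Δ) (hΔ : 0 < Δ) {x₀ : ℝ} (hx₀ : x₀ ∈ P) (hN : N.Nonempty) :
    ∃ t, IsPhaseTime P N x₀ t := by
  have hd : 0 < Real.sqrt (Δ : ℝ) := Real.sqrt_pos.2 (by exact_mod_cast hΔ)
  have hpi := Real.pi_pos
  obtain ⟨z₀, hz₀⟩ := hN
  obtain ⟨a₀, b₀, -, -, hb₀, -, hlt₀, -⟩ := h x₀ hx₀ x₀ hx₀ z₀ hz₀ z₀ hz₀
  have hfin : FiniteMultiplicity (2 : ℤ) b₀ := emultiplicity_lt_top.1 (lt_of_lt_of_le hlt₀ le_top)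
  obtain ⟨e, he⟩ : ∃ e : ℕ, emultiplicity (2 : ℤ) b₀ = e := ⟨_, hfin.emultiplicity_eq_multiplicity⟩
  refine ⟨Real.pi / (2 ^ e * Real.sqrt Δ), fun x hx => ?_, fun w hw => ?_⟩
  · obtain ⟨a, b, -, ha, hb, -, hlt, -⟩ := h x₀ hx₀ x hx z₀ hz₀ z₀ hz₀
    obtain rfl : b = b₀ := by exact_mod_cast hb.symm.trans hb₀
    rw [he] at hlt
    have hdvd : (2 : ℤ) ^ (e + 1) ∣ a := by
      apply pow_dvd_of_le_emultiplicity
      exact_mod_cast Order.add_one_le_of_lt hlt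
    obtain ⟨n, rfl⟩ := hdvd
    refine ⟨n, ?_⟩
    rw [div_eq_iff hd.ne'] at ha
    rw [ha]
    push_cast
    field_simp
    ring
  · obtain ⟨a, b, c, -, hb, hc, -, heq⟩ := h x₀ hx₀ x₀ hx₀ z₀ hz₀ w hw
    obtain rfl : b = b₀ := by exact_mod_cast hb.symm.trans hb₀
    rw [he] at heq
    obtain ⟨⟨o, rfl⟩, hndvd⟩ := emultiplicity_eq_coe.1 heq.symm
    have hodd : Odd o := by
      rw [← Int.not_even_iff_odd, even_iff_two_dvd]
      rintro ⟨o', rfl⟩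
      exact hndvd ⟨o', by ring⟩
    obtain ⟨n, rfl⟩ := hodd
    refine ⟨n, ?_⟩
    rw [div_eq_iff hd.ne'] at hc
    rw [hc]
    push_cast
    field_simp

/-- The set of integers `T` has a nonnegative greatest common divisor, which moreover lies in
every subgroup of `ℤ` containing `T`. -/
theorem exists_gcd_mem_subgroup (T : Set ℤ) :
    ∃ g : ℕ, (∀ z ∈ T, (g : ℤ) ∣ z) ∧ ∀ H : AddSubgroup ℤ, T ⊆ H → (g : ℤ) ∈ H := by
  obtain ⟨a, ha⟩ := Int.subgroup_cyclic (AddSubgroup.closure T)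
  refine ⟨a.natAbs, fun z hz => ?_, fun H hH => ?_⟩
  · have : z ∈ AddSubgroup.closure {a} := ha ▸ AddSubgroup.subset_closure hz
    obtain ⟨n, rfl⟩ := AddSubgroup.mem_closure_singleton.1 this
    rw [Int.natAbs_dvd]
    exact ⟨n, by rw [smul_eq_mul, mul_comm]⟩
  · have h1 : a ∈ H := by
      have : a ∈ AddSubgroup.closure T := by
        rw [ha]
        exact AddSubgroup.subset_closure rfl
      exact (AddSubgroup.closure_le H).2 hH this
    rcases Int.natAbs_eq a with h | h
    · rwa [← h]
    · rw [h] at h1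
      exact neg_mem_iff.1 h1

/-- If there is a phase time at all, the least positive one is `π / (g d)`, where `g` is the
greatest common divisor of the differences of `P ∪ N` divided by `d`. Any base point `y₀` gives
the same `g`, since the differences to it generate the group of all differences. -/
theorem IsPhaseTime.exists_isGCDOf_isLeast {P N : Set ℝ} {x₀ y₀ d t₀ : ℝ}
    (ht₀ : IsPhaseTime P N x₀ t₀) (hd : 0 < d)
    (hx₀ : x₀ ∈ P) (hN : N.Nonempty) (hy₀ : y₀ ∈ P ∪ N)
    (hint : ∀ x ∈ P ∪ N, ∀ y ∈ P ∪ N, ∃ z : ℤ, (x - y) / d = z) :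
    ∃ g : ℕ, IsGCDOf g ((fun x : ℝ => (y₀ - x) / d) '' (P ∪ N)) ∧
      IsLeast {t : ℝ | 0 < t ∧ IsPhaseTime P N x₀ t} (Real.pi / (g * d)) := by
  have hpi := Real.pi_pos
  set T : Set ℤ := {z | ∃ x ∈ P ∪ N, (y₀ - x) / d = z} with hT
  obtain ⟨g, hgdvd, hgmem⟩ := exists_gcd_mem_subgroup T
  have hdiff : ∀ x ∈ P ∪ N, ∃ j : ℤ, x₀ - x = g * j * d := by
    intro x hx
    obtain ⟨z, hz⟩ := hint y₀ hy₀ x hx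
    obtain ⟨z', hz'⟩ := hint y₀ hy₀ x₀ (Or.inl hx₀)
    obtain ⟨i, hi⟩ := hgdvd z ⟨x, hx, hz⟩
    obtain ⟨i', hi'⟩ := hgdvd z' ⟨x₀, Or.inl hx₀, hz'⟩
    rw [div_eq_iff hd.ne', hi] at hz
    rw [div_eq_iff hd.ne', hi'] at hz'
    push_cast at hz hz'
    refine ⟨i - i', ?_⟩
    push_cast
    linear_combination hz - hz'
  -- The integers `z` for which `t d z / π` is an integer form a group containing `T`.
  have hmul : ∀ t, IsPhaseTime P N x₀ t → ∃ n : ℤ, t * d * g = n * Real.pi := by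
    intro t ht
    let H : AddSubgroup ℤ :=
      { carrier := {z | ∃ n : ℤ, t * d * z = n * Real.pi}
        zero_mem' := ⟨0, by simp⟩
        add_mem' := by
          rintro a b ⟨n, hn⟩ ⟨n', hn'⟩
          exact ⟨n + n', by push_cast; linear_combination hn + hn'⟩
        neg_mem' := by
          rintro a ⟨n, hn⟩
          exact ⟨-n, by push_cast; linear_combination -hn⟩ }
    have hTH : T ⊆ H := by
      rintro z ⟨x, hx, hz⟩
      obtain ⟨n, hn⟩ := ht.exists_int hx
      obtain ⟨n', hn'⟩ := ht.exists_int hy₀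
      refine ⟨n - n', ?_⟩
      rw [← hz]
      push_cast
      field_simp
      linear_combination hn - hn'
    obtain ⟨n, hn⟩ := hgmem H hTH
    exact ⟨n, by exact_mod_cast hn⟩
  obtain ⟨μ, hμ⟩ := hN
  obtain ⟨j₀, hj₀⟩ := hdiff μ (Or.inr hμ)
  obtain ⟨n₀, hn₀⟩ := ht₀.2 μ hμ
  obtain ⟨M, hM⟩ := hmul t₀ ht₀
  have hMj : ∀ x j : ℝ, x₀ - x = g * j * d → t₀ * (x₀ - x) = M * j * Real.pi := by
    intro x j hj
    rw [hj]
    linear_combination j * hM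
  have hModd : ∀ j n : ℤ, (M * j * Real.pi : ℝ) = (2 * n + 1) * Real.pi → Odd M ∧ Odd j := by
    intro j n h
    have h1 : M * j = 2 * n + 1 := by exact_mod_cast mul_right_cancel₀ hpi.ne' h
    exact Int.odd_mul.1 ⟨n, h1⟩
  have hM_odd : Odd M := (hModd j₀ n₀ ((hMj μ j₀ hj₀).symm.trans hn₀)).1
  have hg : (0 : ℝ) < g := by
    rcases Nat.eq_zero_or_pos g with h | h
    · rw [h, Nat.cast_zero, mul_zero] at hM
      have hM0 : (M : ℝ) = 0 := (mul_eq_zero.1 hM.symm).resolve_right hpi.ne'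
      have : M = 0 := by exact_mod_cast hM0
      rw [this] at hM_odd
      exact absurd hM_odd (by decide)
    · exact_mod_cast h
  refine ⟨g, ⟨T, ?_, hgdvd, fun e he => ?_⟩, ⟨by positivity, fun x hx => ?_, fun x hx => ?_⟩, ?_⟩
  · ext r
    constructor
    · rintro ⟨x, hx, rfl⟩
      obtain ⟨z, hz⟩ := hint y₀ hy₀ x hx
      exact ⟨z, ⟨x, hx, hz⟩, hz.symm⟩
    · rintro ⟨z, ⟨x, hx, hz⟩, rfl⟩
      exact ⟨x, hx, hz⟩
  · have := hgmem (AddSubgroup.zmultiples e) fun z hz => Int.mem_zmultiples_iff.2 (he z hz)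
    exact Int.mem_zmultiples_iff.1 this
  · obtain ⟨j, hj⟩ := hdiff x (Or.inl hx)
    obtain ⟨n, hn⟩ := ht₀.1 x hx
    rw [hMj x j hj] at hn
    have h1 : M * j = 2 * n := by exact_mod_cast mul_right_cancel₀ hpi.ne' hn
    have h2 : Even j := (Int.even_mul.1 ⟨n, by omega⟩).resolve_left
      (Int.not_even_iff_odd.2 hM_odd)
    obtain ⟨i, rfl⟩ := h2
    refine ⟨i, ?_⟩
    rw [hj]
    push_cast
    field_simp
    ring
  · obtain ⟨j, hj⟩ := hdiff x (Or.inr hx)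
    obtain ⟨n, hn⟩ := ht₀.2 x hx
    rw [hMj x j hj] at hn
    obtain ⟨i, rfl⟩ := (hModd j n hn).2
    refine ⟨i, ?_⟩
    rw [hj]
    push_cast
    field_simp
  · rintro t ⟨ht, hph⟩
    obtain ⟨n, hn⟩ := hmul t hph
    have h1 : (0 : ℝ) < n := by
      have : (0 : ℝ) < n * Real.pi := by rw [← hn]; positivity
      exact pos_of_mul_pos_left this hpi.le
    have h2 : (1 : ℝ) ≤ n := by exact_mod_cast h1
    rw [div_le_iff₀ (by positivity)]
    nlinarith

end JoinPST

/-! ### Integrality of the eigenvalues -/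

namespace JoinPST

open WGraph

theorem exists_int_of_isIntegral_mul_sqrt {Δ : ℕ} (hΔ : Squarefree Δ) (q : ℚ)
    (h : IsIntegral ℤ ((q : ℝ) * Real.sqrt (Δ : ℝ))) : ∃ z : ℤ, q = z := by
  have h1 : IsIntegral ℤ (algebraMap ℚ ℝ (q ^ 2 * Δ)) := by
    convert h.pow 2 using 1
    rw [mul_pow, Real.sq_sqrt (Nat.cast_nonneg Δ)]
    simp
  rw [isIntegral_algebraMap_iff (algebraMap ℚ ℝ).injective] at h1
  obtain ⟨z, hz⟩ := IsIntegrallyClosed.isIntegral_iff.1 h1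
  rw [eq_intCast] at hz
  have h2 : q.num ^ 2 * (Δ : ℤ) = (q.den : ℤ) ^ 2 * z := by
    have : (q.num : ℚ) ^ 2 * Δ = (q.den : ℚ) ^ 2 * z := by
      rw [hz, ← Rat.mul_den_eq_num]
      ring
    exact_mod_cast this
  have h3 : IsCoprime ((q.den : ℤ) ^ 2) (q.num ^ 2) := by
    apply IsCoprime.pow
    rw [Int.isCoprime_iff_gcd_eq_one, Int.gcd_comm]
    exact q.reduced
  have h4 : (q.den : ℤ) ^ 2 ∣ (Δ : ℤ) := h3.dvd_of_dvd_mul_left ⟨z, h2⟩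
  have h5 : q.den * q.den ∣ Δ := by
    rw [← sq]
    exact_mod_cast h4
  have h6 : q.den = 1 := Nat.isUnit_iff.1 (hΔ _ h5)
  exact ⟨q.num, (Rat.den_eq_one_iff q).1 h6 |>.symm⟩

theorem irrational_sqrt_of_squarefree {Δ : ℕ} (h1 : 1 < Δ) (hΔ : Squarefree Δ) :
    Irrational (Real.sqrt (Δ : ℝ)) := by
  rw [irrational_sqrt_natCast_iff]
  rintro ⟨r, rfl⟩
  have := Nat.isUnit_iff.1 (hΔ r dvd_rfl)
  subst this
  omega

/-- For `y² = d`, an integer polynomial takes at `k + y` a value `P + Q y`, where the integers `P`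
and `Q` are the same for both square roots `y` of `d`. -/
theorem exists_aeval_add_eq (p : Polynomial ℤ) (k d : ℤ) :
    ∃ P Q : ℤ, ∀ y : ℝ, y ^ 2 = d → Polynomial.aeval ((k : ℝ) + y) p = P + Q * y := by
  induction p using Polynomial.induction_on' with
  | add p q hp hq =>
    obtain ⟨P, Q, h⟩ := hp
    obtain ⟨P', Q', h'⟩ := hq
    refine ⟨P + P', Q + Q', fun y hy => ?_⟩
    rw [map_add, h y hy, h' y hy]
    push_cast
    ring
  | monomial n a =>
    induction n with
    | zero => exact ⟨a, 0, fun y _ => by simp⟩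
    | succ n ih =>
      obtain ⟨P, Q, h⟩ := ih
      refine ⟨k * P + Q * d, P + k * Q, fun y hy => ?_⟩
      have h1 := h y hy
      rw [Polynomial.aeval_monomial] at h1 ⊢
      rw [pow_succ, ← mul_assoc, h1]
      push_cast
      rw [← hy]
      ring

/-- Roots `k + y` of an integer polynomial, with `y` irrational and `y²` an integer, come in
conjugate pairs. -/
theorem aeval_sub_eq_zero {p : Polynomial ℤ} {k d : ℤ} {y : ℝ} (hy : y ^ 2 = d)
    (hirr : Irrational y) (h : Polynomial.aeval ((k : ℝ) + y) p = 0) :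
    Polynomial.aeval ((k : ℝ) - y) p = 0 := by
  obtain ⟨P, Q, hPQ⟩ := exists_aeval_add_eq p k d
  rw [hPQ y hy] at h
  have hQ : Q = 0 := by
    by_contra hQ
    apply (hirr.intCast_mul hQ).ne_int (-P)
    push_cast
    linarith
  rw [sub_eq_add_neg, hPQ (-y) (by rw [neg_sq, hy])]
  rw [hQ] at h ⊢
  simpa using h

variable {V W : Type*} [Fintype V] [DecidableEq V]

theorem isRoot_charpoly_iff (X : WGraph V) (x : ℝ) :
    X.adjMatrix.charpoly.IsRoot x ↔ ∃ f, X.IsEigenfunction x f ∧ f ≠ 0 := by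
  rw [Polynomial.IsRoot, Matrix.eval_charpoly, ← Matrix.exists_mulVec_eq_zero_iff]
  refine exists_congr fun f => ?_
  rw [and_comm, Matrix.sub_mulVec, isEigenfunction_iff_mulVec, sub_eq_zero, Matrix.scalar_apply,
    ← Matrix.smul_one_eq_diagonal, Matrix.smul_mulVec, Matrix.one_mulVec, eq_comm]

theorem isRoot_charpoly_of_mem_supp {X : WGraph V} {x : ℝ} {u : V} (hx : x ∈ X.supp u) :
    X.adjMatrix.charpoly.IsRoot x := by
  obtain ⟨f, hf, hfu⟩ := (X.mem_supp_iff x u).1 hx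
  refine (isRoot_charpoly_iff X x).2 ⟨f, hf, ?_⟩
  rintro rfl
  exact hfu rfl

theorem isIntegral_of_mem_supp {X : WGraph V} (hφ : X.HasIntegralCharpoly) {x : ℝ} {u : V}
    (hx : x ∈ X.supp u) : IsIntegral ℤ x := by
  obtain ⟨p, hp⟩ := hφ
  have h := isRoot_charpoly_of_mem_supp hx
  rw [hp, Polynomial.IsRoot, Polynomial.eval_map] at h
  refine ⟨p, ?_, h⟩
  apply Polynomial.monic_of_injective (Int.castRingHom ℝ).injective_int
  rw [← hp]
  exact Matrix.charpoly_monic _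

theorem isIntegral_of_quotient_root {m n : ℕ} {k l : ℤ} {x : ℝ}
    (hx : (x - k) * (x - l) = m * n) : IsIntegral ℤ x := by
  refine ⟨(Polynomial.X - Polynomial.C k) * (Polynomial.X - Polynomial.C l)
    - Polynomial.C ((m : ℤ) * n), ?_, ?_⟩
  · apply Polynomial.Monic.sub_of_left
    · exact (Polynomial.monic_X_sub_C k).mul (Polynomial.monic_X_sub_C l)
    · rw [Polynomial.degree_mul, Polynomial.degree_X_sub_C, Polynomial.degree_X_sub_C]
      exact lt_of_le_of_lt Polynomial.degree_C_le (by norm_num)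
  · rw [Polynomial.eval₂_sub, Polynomial.eval₂_mul, Polynomial.eval₂_sub, Polynomial.eval₂_sub]
    simp only [Polynomial.eval₂_X, Polynomial.eval₂_C]
    simp [hx]

theorem le_degree_of_mem_supp {X : WGraph V} {k x : ℝ} (hX : X.IsWeightedRegular k)
    {u : V} (hx : x ∈ X.supp u) : x ≤ k := by
  obtain ⟨f, hf, hfu⟩ := (X.mem_supp_iff x u).1 hx
  by_contra! h
  exact hfu (hX.eq_zero_of_lt hf h u)

variable [Fintype W] [DecidableEq W] [Nonempty W] {X : WGraph V} {Y : WGraph W} {k l : ℤ}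

theorem isIntegral_of_mem_supp_join (hX : X.IsWeightedRegular (k : ℝ))
    (hY : Y.IsWeightedRegular (l : ℝ)) (hφ : X.HasIntegralCharpoly) {u : V} {x : ℝ}
    (hx : x ∈ (X.join Y).supp (Sum.inl u)) : IsIntegral ℤ x := by
  rw [mem_supp_join_iff hX hY] at hx
  rcases hx with hx | hx | hx | ⟨-, rfl⟩
  · exact isIntegral_of_mem_supp hφ hx.1
  · exact isIntegral_of_quotient_root ((quotient_root_iff _ _ k l x).2 (Or.inl hx))
  · exact isIntegral_of_quotient_root ((quotient_root_iff _ _ k l x).2 (Or.inr hx))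
  · exact isIntegral_algebraMap (R := ℤ) (x := k)

theorem EigenvalueCondition.squarefree {n : ℕ} {u : V} {Δ : ℕ}
    (h : EigenvalueCondition X n k l u Δ) : Squarefree Δ := by
  rcases h with ⟨-, rfl⟩ | h
  · exact squarefree_one
  · exact h.2.2.1

theorem sqrt_disc_eq_of_isSquare {m n : ℕ} (h : IsSquare (disc m n k l)) :
    ∃ r : ℤ, Real.sqrt ((disc m n k l : ℤ) : ℝ) = r := by
  obtain ⟨r, hr⟩ := h
  refine ⟨|r|, ?_⟩
  rw [hr, Int.cast_mul, Real.sqrt_mul_self_eq_abs, Int.cast_abs]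

/-- Both alternatives of the eigenvalue condition give all eigenvalues in the support in the join
the same form, with `Δ = 1` in the integral one. -/
theorem EigenvalueCondition.exists_eq (hX : X.IsWeightedRegular (k : ℝ))
    (hY : Y.IsWeightedRegular (l : ℝ)) {u : V} {Δ : ℕ}
    (h : EigenvalueCondition X (Fintype.card W) k l u Δ) {x : ℝ}
    (hx : x ∈ (X.join Y).supp (Sum.inl u)) :
    ∃ c : ℤ, x = ((k : ℝ) + l + c * Real.sqrt (Δ : ℝ)) / 2 := by
  rw [mem_supp_join_iff hX hY] at hx
  rcases h with ⟨⟨hint, hsq⟩, rfl⟩ | ⟨hc, -, -, b, hb, hb', hs⟩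
  · obtain ⟨r, hr⟩ := sqrt_disc_eq_of_isSquare hsq
    simp only [Nat.cast_one, Real.sqrt_one, mul_one]
    rcases hx with hx | hx | hx | ⟨-, rfl⟩
    · obtain ⟨z, rfl⟩ := hint x hx.1
      exact ⟨2 * z - k - l, by push_cast; ring⟩
    · exact ⟨r, by rw [hx, lamPlus, hr]⟩
    · exact ⟨-r, by rw [hx, lamMinus, hr]; push_cast; ring⟩
    · exact ⟨k - l, by push_cast; ring⟩
  · rcases hx with hx | hx | hx | ⟨hcon, rfl⟩
    · obtain ⟨c, hc, -⟩ := hs x hx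
      exact ⟨c, hc⟩
    · exact ⟨b, hx.trans hb⟩
    · exact ⟨-b, by rw [hx, hb']; push_cast; ring⟩
    · obtain ⟨-, rfl⟩ := hc.resolve_left hcon
      exact ⟨0, by push_cast; ring⟩

theorem EigenvalueCondition.exists_int_sub_div (hX : X.IsWeightedRegular (k : ℝ))
    (hY : Y.IsWeightedRegular (l : ℝ)) (hφ : X.HasIntegralCharpoly) {u : V} {Δ : ℕ}
    (h : EigenvalueCondition X (Fintype.card W) k l u Δ) {x y : ℝ}
    (hx : x ∈ (X.join Y).supp (Sum.inl u)) (hy : y ∈ (X.join Y).supp (Sum.inl u)) :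
    ∃ z : ℤ, (x - y) / Real.sqrt (Δ : ℝ) = z := by
  have hΔ := h.squarefree
  have hd : 0 < Real.sqrt (Δ : ℝ) :=
    Real.sqrt_pos.2 (by exact_mod_cast Nat.pos_of_ne_zero hΔ.ne_zero)
  obtain ⟨c, hc⟩ := h.exists_eq hX hY hx
  obtain ⟨c', hc'⟩ := h.exists_eq hX hY hy
  have hxy : x - y = (((c - c' : ℤ) / 2 : ℚ) : ℝ) * Real.sqrt (Δ : ℝ) := by
    rw [hc, hc']
    push_cast
    ring
  have hi := (isIntegral_of_mem_supp_join hX hY hφ hx).sub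
    (isIntegral_of_mem_supp_join hX hY hφ hy)
  rw [hxy] at hi
  obtain ⟨z, hz⟩ := exists_int_of_isIntegral_mul_sqrt hΔ _ hi
  refine ⟨z, ?_⟩
  rw [hxy, hz, mul_div_cancel_right₀ _ hd.ne', Rat.cast_intCast]

/-- If the eigenvalues in the support of `u` in the join differ from `λ⁺` by rational multiples of
`√D`, and `D` is a perfect square, then the eigenvalues are integers. -/
theorem integralCase_of_rational (hX : X.IsWeightedRegular (k : ℝ))
    (hY : Y.IsWeightedRegular (l : ℝ)) (hφ : X.HasIntegralCharpoly) {u : V}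
    (hsq : IsSquare (disc (Fintype.card V) (Fintype.card W) k l))
    (hq : ∀ x ∈ (X.join Y).supp (Sum.inl u), ∃ q : ℚ,
      lamPlus (Fintype.card V) (Fintype.card W) k l - x
        = q * Real.sqrt ((disc (Fintype.card V) (Fintype.card W) k l : ℤ) : ℝ)) :
    IntegralCase X (Fintype.card W) k l u := by
  refine ⟨fun x hx => ?_, hsq⟩
  by_cases hxk : x = k
  · exact ⟨k, hxk⟩
  have hxj : x ∈ (X.join Y).supp (Sum.inl u) :=
    (mem_supp_join_iff hX hY u x).2 (Or.inl ⟨hx, hxk⟩)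
  obtain ⟨q, hq⟩ := hq x hxj
  obtain ⟨r, hr⟩ := sqrt_disc_eq_of_isSquare hsq
  have hx' : x = (((k + l + r) / 2 - q * r : ℚ) : ℝ) := by
    rw [lamPlus, hr] at hq
    push_cast
    linarith
  have hi := isIntegral_of_mem_supp hφ hx
  obtain ⟨z, hz⟩ := exists_int_of_isIntegral_mul_sqrt squarefree_one
    ((k + l + r) / 2 - q * r) (by simpa [← hx'] using hi)
  exact ⟨z, by rw [hx', hz, Rat.cast_intCast]⟩

/-- If the eigenvalues in the support of `u` in the join differ from `λ⁺` by rational multiples of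
`√D`, and `D` is not a perfect square, then the quadratic alternative holds. If `X` is disconnected,
then `k` is in the support, so that `k = l`; if moreover `X ≠ O₂(k)`, some eigenvalue `k + e √Δ`
with `e ≠ 0` is in the support of `u` in `X`, and it or its conjugate exceeds the degree. -/
theorem exists_quadraticCase_of_rational (hX : X.IsWeightedRegular (k : ℝ))
    (hY : Y.IsWeightedRegular (l : ℝ)) (hφ : X.HasIntegralCharpoly) {u : V}
    (hsq : ¬ IsSquare (disc (Fintype.card V) (Fintype.card W) k l))
    (hq : ∀ x ∈ (X.join Y).supp (Sum.inl u), ∃ q : ℚ,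
      lamPlus (Fintype.card V) (Fintype.card W) k l - x
        = q * Real.sqrt ((disc (Fintype.card V) (Fintype.card W) k l : ℤ) : ℝ))
    (hne : ¬ X.IsO2 (k : ℝ) → ∃ x ∈ X.supp u, x ≠ k) :
    ∃ Δ, QuadraticCase X (Fintype.card W) k l u Δ := by
  have : Nonempty V := ⟨u⟩
  have hDpos := disc_pos (m := Fintype.card V) (n := Fintype.card W)
    Fintype.card_pos Fintype.card_pos k l
  have hlam := degree_lt_lamPlus (m := Fintype.card V) (n := Fintype.card W)
    Fintype.card_pos Fintype.card_pos k l
  obtain ⟨Δ, b, hDb, hΔ⟩ := Nat.sq_mul_squarefree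
    (disc (Fintype.card V) (Fintype.card W) k l).toNat
  have hD : disc (Fintype.card V) (Fintype.card W) k l = (b : ℤ) ^ 2 * Δ := by
    have := Int.toNat_of_nonneg hDpos.le
    rw [← this, ← hDb]
    push_cast
    ring
  have hΔ1 : 1 < Δ := by
    rcases Nat.lt_or_ge 1 Δ with h | h
    · exact h
    · exfalso
      have h0 := hΔ.ne_zero
      have : Δ = 1 := by omega
      apply hsq
      rw [hD, this]
      exact ⟨b, by push_cast; ring⟩
  have hsqrt : Real.sqrt ((disc (Fintype.card V) (Fintype.card W) k l : ℤ) : ℝ)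
      = b * Real.sqrt (Δ : ℝ) := by
    rw [hD]
    push_cast
    rw [Real.sqrt_mul (by positivity), Real.sqrt_sq (by positivity)]
  have hd : 0 < Real.sqrt (Δ : ℝ) := Real.sqrt_pos.2 (by exact_mod_cast Nat.zero_lt_of_lt hΔ1)
  have hirr := irrational_sqrt_of_squarefree hΔ1 hΔ
  have hform : ∀ x ∈ (X.join Y).supp (Sum.inl u),
      ∃ c : ℤ, x = ((k : ℝ) + l + c * Real.sqrt (Δ : ℝ)) / 2 := by
    intro x hx
    obtain ⟨q, hq⟩ := hq x hx
    rw [lamPlus, hsqrt] at hq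
    have h1 : 2 * x - k - l = (((1 - 2 * q) * b : ℚ) : ℝ) * Real.sqrt (Δ : ℝ) := by
      push_cast
      linear_combination -2 * hq
    have hi : IsIntegral ℤ (2 * x - k - l) := by
      have h2 : ∀ z : ℤ, IsIntegral ℤ (z : ℝ) := fun z => isIntegral_algebraMap (R := ℤ) (x := z)
      exact_mod_cast (((h2 2).mul (isIntegral_of_mem_supp_join hX hY hφ hx)).sub (h2 k)).sub (h2 l)
    rw [h1] at hi
    obtain ⟨c, hc⟩ := exists_int_of_isIntegral_mul_sqrt hΔ _ hi
    rw [hc, Rat.cast_intCast] at h1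
    exact ⟨c, by linarith⟩
  have hpart : X.IsConnected ∨ (X.IsO2 (k : ℝ) ∧ k = l) := by
    by_contra! hcon
    obtain ⟨hdis, hO⟩ := hcon
    have hkl : k = l := by
      obtain ⟨c, hc⟩ := hform k ((degree_mem_supp_join_iff hX hY u).2 hdis)
      have hc0 : c = 0 := by
        by_contra hc0
        apply (hirr.intCast_mul hc0).ne_int (k - l)
        push_cast
        linarith
      rw [hc0, Int.cast_zero, zero_mul] at hc
      have : (k : ℝ) = l := by linarith
      exact_mod_cast this
    obtain ⟨x, hx, hxk⟩ := hne fun h => hO h hkl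
    obtain ⟨c, hc⟩ := hform x ((mem_supp_join_iff hX hY u x).2 (Or.inl ⟨hx, hxk⟩))
    have hxc : x - k = ((c / 2 : ℚ) : ℝ) * Real.sqrt (Δ : ℝ) := by
      rw [hc, ← hkl]
      push_cast
      ring
    have hi := (isIntegral_of_mem_supp hφ hx).sub (isIntegral_algebraMap (R := ℤ) (A := ℝ) (x := k))
    rw [eq_intCast, hxc] at hi
    obtain ⟨e, he⟩ := exists_int_of_isIntegral_mul_sqrt hΔ _ hi
    rw [he, Rat.cast_intCast] at hxc
    have he0 : e ≠ 0 := by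
      rintro rfl
      rw [Int.cast_zero, zero_mul] at hxc
      exact hxk (by linarith)
    obtain ⟨p, hp⟩ := hφ
    have hroot : Polynomial.aeval ((k : ℝ) + e * Real.sqrt (Δ : ℝ)) p = 0 := by
      have h := isRoot_charpoly_of_mem_supp hx
      rw [hp, Polynomial.IsRoot, Polynomial.eval_map] at h
      rwa [← hxc, add_sub_cancel]
    have hroot' := aeval_sub_eq_zero (d := e ^ 2 * Δ)
      (by rw [mul_pow, Real.sq_sqrt (Nat.cast_nonneg Δ)]; push_cast; ring)
      (hirr.intCast_mul he0) hroot
    have heig : X.adjMatrix.charpoly.IsRoot ((k : ℝ) - e * Real.sqrt (Δ : ℝ)) := by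
      rw [hp, Polynomial.IsRoot, Polynomial.eval_map]
      exact hroot'
    obtain ⟨f, hf, hf0⟩ := (isRoot_charpoly_iff X _).1 heig
    have hle : (k : ℝ) - e * Real.sqrt (Δ : ℝ) ≤ k := by
      by_contra! h
      exact hf0 (funext fun a => hX.eq_zero_of_lt hf h a)
    have hle' := le_degree_of_mem_supp hX hx
    have : (e : ℝ) * Real.sqrt (Δ : ℝ) = 0 := by linarith
    exact he0 (by exact_mod_cast (mul_eq_zero.1 this).resolve_right hd.ne')
  refine ⟨Δ, hpart, hΔ1, hΔ, b, ?_, ?_, fun x hx => ?_⟩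
  · rw [lamPlus, hsqrt, Int.cast_natCast]
  · rw [lamMinus, hsqrt, Int.cast_natCast]
  · obtain ⟨c, hc⟩ := hform x ((mem_supp_join_iff hX hY u x).2 (Or.inl hx))
    refine ⟨c, hc, ?_⟩
    have hle := le_degree_of_mem_supp hX hx.1
    rw [lamPlus, hsqrt] at hlam
    have h1 : (c : ℝ) * Real.sqrt (Δ : ℝ) < b * Real.sqrt (Δ : ℝ) := by linarith
    exact_mod_cast lt_of_mul_lt_mul_right h1 hd.le

end JoinPST

/-! ### State transfer in the join -/

namespace JoinPST

open WGraph

variable {V W : Type*} [Fintype V] [DecidableEq V] [Fintype W] [DecidableEq W] [Nonempty W]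
  {X : WGraph V} {Y : WGraph W} {k l : ℤ}

theorem norm_transition_join_eq_one_iff (hX : X.IsWeightedRegular (k : ℝ))
    (hY : Y.IsWeightedRegular (l : ℝ)) {u v : V}
    (hsc : (X.join Y).StronglyCospectral (Sum.inl u) (Sum.inl v)) (t : ℝ) :
    ‖(X.join Y).transition t (Sum.inl u) (Sum.inl v)‖ = 1 ↔
      IsPhaseTime ((X.join Y).suppPlus (Sum.inl u) (Sum.inl v))
        ((X.join Y).suppMinus (Sum.inl u) (Sum.inl v))
        (lamPlus (Fintype.card V) (Fintype.card W) k l) t := by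
  rw [norm_transition_eq_one_iff_stronglyCospectral _ t _ _
    (mem_suppPlus_join_of_root hX hY hsc (lamPlus_root _ _ k l))]
  exact and_iff_right hsc

/-- The eigenvalue condition is necessary: eigenvalues in the support differ from `λ⁺` by rational
multiples of `λ⁺ - λ⁻ = √D`. -/
theorem exists_eigenvalueCondition (hX : X.IsWeightedRegular (k : ℝ))
    (hY : Y.IsWeightedRegular (l : ℝ)) (hφ : X.HasIntegralCharpoly) {u v : V} (huv : u ≠ v)
    (hsc : (X.join Y).StronglyCospectral (Sum.inl u) (Sum.inl v)) {t : ℝ}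
    (ht : IsPhaseTime ((X.join Y).suppPlus (Sum.inl u) (Sum.inl v))
      ((X.join Y).suppMinus (Sum.inl u) (Sum.inl v))
      (lamPlus (Fintype.card V) (Fintype.card W) k l) t) :
    ∃ Δ, EigenvalueCondition X (Fintype.card W) k l u Δ := by
  have : Nonempty V := ⟨u⟩
  have hD := disc_pos (m := Fintype.card V) (n := Fintype.card W)
    Fintype.card_pos Fintype.card_pos k l
  have hq : ∀ x ∈ (X.join Y).supp (Sum.inl u), ∃ q : ℚ,
      lamPlus (Fintype.card V) (Fintype.card W) k l - x
        = q * Real.sqrt ((disc (Fintype.card V) (Fintype.card W) k l : ℤ) : ℝ) := by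
    intro x hx
    rw [hsc.supp_eq] at hx
    rw [← lamPlus_sub_lamMinus]
    refine ht.exists_rat (hsc.suppMinus_nonempty (Sum.inl_injective.ne huv))
      (Or.inl (mem_suppPlus_join_of_root hX hY hsc (lamMinus_root _ _ k l))) ?_ hx
    have h1 := lamPlus_sub_lamMinus (Fintype.card V) (Fintype.card W) k l
    have h2 : 0 < Real.sqrt ((disc (Fintype.card V) (Fintype.card W) k l : ℤ) : ℝ) :=
      Real.sqrt_pos.2 (by exact_mod_cast hD)
    intro h
    rw [h] at h1
    linarith
  by_cases hsq : IsSquare (disc (Fintype.card V) (Fintype.card W) k l)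
  · exact ⟨1, Or.inl ⟨integralCase_of_rational hX hY hφ hsq hq, rfl⟩⟩
  · obtain ⟨Δ, hΔ⟩ := exists_quadraticCase_of_rational hX hY hφ hsq hq (by
      intro hO
      have h := (stronglyCospectral_of_join hX hY huv hsc hO).1
      obtain ⟨x, hx⟩ := h.suppMinus_nonempty huv
      have hx' := ((mem_suppMinus_iff _ _ _ _).1 hx).2
      refine ⟨x, hx', ?_⟩
      rintro rfl
      exact not_mem_suppPlus_of_mem_suppMinus hx
        ((mem_suppPlus_iff _ _ _ _).2 ⟨eq_of_stronglyCospectral_degree hX h, hx'⟩))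
    exact ⟨Δ, Or.inr hΔ⟩

end JoinPST

theorem theorem7p5 {V W : Type*} [Fintype V] [DecidableEq V] [Fintype W] [DecidableEq W]
    [Nonempty W] (X : WGraph V) (Y : WGraph W) (k l : ℤ) (hm : 2 ≤ Fintype.card V)
    (hX : X.IsWeightedRegular (k : ℝ)) (hY : Y.IsWeightedRegular (l : ℝ))
    (hφ : X.HasIntegralCharpoly) (u v : V) (huv : u ≠ v) :
    ((X.join Y).HasPST (Sum.inl u) (Sum.inl v) ↔
      ((X.StronglyCospectral u v ∧
          JoinPST.lamMinus (Fintype.card V) (Fintype.card W) k l ∉ X.suppMinus u v) ∨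
        X.IsO2 (k : ℝ)) ∧
      ∃ Δ : ℕ, JoinPST.EigenvalueCondition X (Fintype.card W) k l u Δ ∧
        JoinPST.ValuationCondition (JoinPST.augPlus X (Fintype.card W) k l u v)
          (JoinPST.augMinus X k u v) Δ) ∧
    ((X.join Y).HasPST (Sum.inl u) (Sum.inl v) →
      ∀ Δ : ℕ, JoinPST.EigenvalueCondition X (Fintype.card W) k l u Δ →
      ∀ x₀ ∈ ((X.join Y).suppPlus (Sum.inl u) (Sum.inl v) \ {(k : ℝ)}) ∪
          JoinPST.extra X (Fintype.card W) k l,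
      ∃ g : ℕ,
        JoinPST.IsGCDOf g ((fun x : ℝ => (x₀ - x) / Real.sqrt (Δ : ℝ)) ''
          (((X.join Y).supp (Sum.inl u) \ {(k : ℝ)}) ∪
            JoinPST.extra X (Fintype.card W) k l)) ∧
        (X.join Y).IsMinPSTTime (Sum.inl u) (Sum.inl v)
          (Real.pi / ((g : ℝ) * Real.sqrt (Δ : ℝ)))) := by
  open JoinPST WGraph in
  have huv' : (Sum.inl u : V ⊕ W) ≠ Sum.inl v := Sum.inl_injective.ne huv
  have hscPST : ∀ t, ‖(X.join Y).transition t (Sum.inl u) (Sum.inl v)‖ = 1 →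
      (X.join Y).StronglyCospectral (Sum.inl u) (Sum.inl v) := fun t ht =>
    stronglyCospectral_of_norm_transition_eq_one _ ht
  have hint : (X.join Y).StronglyCospectral (Sum.inl u) (Sum.inl v) → ∀ Δ : ℕ,
      EigenvalueCondition X (Fintype.card W) k l u Δ →
      ∀ x ∈ (X.join Y).suppPlus (Sum.inl u) (Sum.inl v) ∪
        (X.join Y).suppMinus (Sum.inl u) (Sum.inl v),
      ∀ y ∈ (X.join Y).suppPlus (Sum.inl u) (Sum.inl v) ∪
        (X.join Y).suppMinus (Sum.inl u) (Sum.inl v),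
      ∃ z : ℤ, (x - y) / Real.sqrt (Δ : ℝ) = z := by
    intro hsc Δ hΔ
    rw [← hsc.supp_eq]
    exact fun x hx y hy => hΔ.exists_int_sub_div hX hY hφ hx hy
  refine ⟨⟨?_, ?_⟩, ?_⟩
  · rintro ⟨t, ht⟩
    have hsc := hscPST t ht
    rw [norm_transition_join_eq_one_iff hX hY hsc] at ht
    obtain ⟨Δ, hΔ⟩ := exists_eigenvalueCondition hX hY hφ huv hsc ht
    refine ⟨(stronglyCospectral_join_iff hX hY huv).1 hsc, Δ, hΔ, ?_⟩
    rw [← suppPlus_join_eq_augPlus hX hY huv hsc, ← suppMinus_join_eq_augMinus hX hY huv hsc]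
    exact ht.valuationCondition (Nat.pos_of_ne_zero hΔ.squarefree.ne_zero) (hint hsc Δ hΔ)
  · rintro ⟨h1, Δ, hΔ, hval⟩
    have hsc := (stronglyCospectral_join_iff hX hY huv).2 h1
    rw [← suppPlus_join_eq_augPlus hX hY huv hsc, ← suppMinus_join_eq_augMinus hX hY huv hsc]
      at hval
    obtain ⟨t, ht⟩ := hval.exists_isPhaseTime (Nat.pos_of_ne_zero hΔ.squarefree.ne_zero)
      (mem_suppPlus_join_of_root hX hY hsc (lamPlus_root _ _ k l)) (hsc.suppMinus_nonempty huv')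
    exact ⟨t, (norm_transition_join_eq_one_iff hX hY hsc t).2 ht⟩
  · rintro ⟨t, ht⟩ Δ hΔ x₀ hx₀
    have hsc := hscPST t ht
    rw [norm_transition_join_eq_one_iff hX hY hsc] at ht
    have hx₀s : x₀ ∈ (X.join Y).supp (Sum.inl u) := by
      rcases hx₀ with hx₀ | hx₀
      · exact ((mem_suppPlus_iff _ _ _ _).1 hx₀.1).2
      · exact extra_subset_supp_join hX hY u hx₀
    rw [hsc.supp_eq] at hx₀s
    rw [supp_join_sdiff_union_extra hX hY, hsc.supp_eq]
    simp only [IsMinPSTTime, norm_transition_join_eq_one_iff hX hY hsc]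
    exact ht.exists_isGCDOf_isLeast
      (Real.sqrt_pos.2 (by exact_mod_cast Nat.pos_of_ne_zero hΔ.squarefree.ne_zero))
      (mem_suppPlus_join_of_root hX hY hsc (lamPlus_root _ _ k l)) (hsc.suppMinus_nonempty huv')
      hx₀s (hint hsc Δ hΔ)
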